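/- Let $W$ be a Cantor set and let $g:W\to W$ be a totally transitive homeomorphism ($g^n$ is topologically transitive for all integers $n\neq 0$). Let $Y$ be the suspension of $g$, that is, $W\times[0,1]$ with $(x,1)$ identified with $(g(x),0)$ for all $x\in W$, and let $\phi^t(x,s)=(g^{\lfloor t+s\rfloor}(x),\{t+s\})$ be the suspension flow. Let $x_0\in W$ be a transitive point of $g^n$ (its forward $g^n$-orbit is dense in $W$) for every $n\in\mathbb Z\setminus\{0\}$, put $y_0=(x_0,0)\in Y$, and let $\tau\in(0,1)$ be such that $y_0$ is a transitive point of $f^n$ for every $n\in\mathbb Z\setminus\{0\}$, where $f=\phi^\tau$. Let $(a_n)_{n\in\mathbb Z}$ be positive reals with $\sum_n a_n=1$ and $\{|\ln a_n-\ln a_{n-1}|:n\in\mathbb Z\}$ bounded. Let $u:Y\setminus\{y_0\}\to[0,1]$ be continuous with $$u(\phi^t(y_0))=\begin{cases}0,&-\tfrac12\le t<0,\\ \tfrac12\left(1-\cos(\pi/t)\right),&0<t\le\tfrac12.\end{cases}$$ Put $Y'=Y\setminus\{f^n(y_0):n\in\mathbb Z\}$ and $u'=\sum_{n\in\mathbb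 Z}a_n\,(u\circ f^n)$ on $Y'$. Let $X$ be the closure in $Y\times[0,1]$ of the graph of $u'$, with first coordinate projection $\pi:X\to Y$. Let $B$ be a proper closed subset of $W$ with $g(B)=B$, let $A$ be a compact metrizable space, and let $r:B\to A$ be a continuous surjection with $r\circ g=r$ on $B$. Let $\hat B$ be the image of $B\times[0,1]$ in $Y$, and let $\hat r:\hat B\to A$ be the map $(x,s)\mapsto r(x)$. Let $X_r$ be the quotient space of $X$ in which two points $p,q\in X$ are identified if $p=q$, or if $\pi(p),\pi(q)\in\hat B$ and $\hat r(\pi(p))=\hat r(\pi(q))$. Then the homeomorphism $(y,u'(y))\mapsto(f(y),u'(f(y)))$ of the graph of $u'$ extends to a homeomorphism $h$ of $X$, and $h$ induces a homeomorphism $h_r$ of $X_r$. The group $H(X_r)$ of all homeomorphisms of $X_r$ onto itself is $$H(X_r)=\{h_r^n:n\in\mathbb Z\},$$ and $h_r^n$ is topologically transitive for every integer $n\neq 0$. Here a map $k$ of a space $Z$ is called topologically transitive if $\{(z,k^m(z)):z\in Z,\ m\ge 1\}$ is dense in $Z\times Z$. -/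

import Mathlib

open Set Topology

noncomputable section

/-! ### Transitivity -/

/-- `x` is a transitive point of `f`: the closure of the positive orbit `{f x, f² x, …}` is
the whole space. -/
def IsTransitivePoint {α : Type*} [TopologicalSpace α] (f : α → α) (x : α) : Prop :=
  closure {y | ∃ k : ℕ, 1 ≤ k ∧ y = f^[k] x} = univ

/-- `f` is topologically transitive: the closure of the orbit relation
`{(x, fᵏ x) : k ≥ 1}` is all of `α × α`. -/
def IsTopTransitive {α : Type*} [TopologicalSpace α] (f : α → α) : Prop :=
  closure {p : α × α | ∃ k : ℕ, 1 ≤ k ∧ p.2 = f^[k] p.1} = univ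

/-- `g` is totally transitive: `gⁿ` is topologically transitive for every integer `n ≠ 0`. -/
def IsTotallyTransitive {α : Type*} [TopologicalSpace α] (g : α ≃ₜ α) : Prop :=
  ∀ n : ℤ, n ≠ 0 → IsTopTransitive (g ^ n : α ≃ₜ α)

/-! ### The suspension and its flow -/

section Suspension

variable {W : Type*} [TopologicalSpace W]

/-- The identification of `(x, 1)` with `(g x, 0)`. -/
def SuspensionRel (g : W ≃ₜ W) (p q : W × unitInterval) : Prop :=
  p.2 = 1 ∧ q = (g p.1, 0)

/-- The suspension of `g`: the space `W × [0,1]` with `(x, 1)` identified with `(g x, 0)`,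
with the quotient topology. -/
abbrev Suspension (g : W ≃ₜ W) : Type _ := Quot (SuspensionRel g)

/-- The time `t` map of the suspension flow,
`(x, s) ↦ (g^⌊t + s⌋ x, fract (t + s))`. -/
def suspensionFlow (g : W ≃ₜ W) (t : ℝ) : Suspension g → Suspension g :=
  Quot.lift
    (fun p => Quot.mk (SuspensionRel g)
      ((g ^ ⌊t + (p.2 : ℝ)⌋ : W ≃ₜ W) p.1,
        ⟨Int.fract (t + (p.2 : ℝ)), Int.fract_nonneg _, (Int.fract_lt_one _).le⟩))
    (by
      rintro ⟨x, s⟩ q ⟨hs, rfl⟩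
      obtain rfl : s = 1 := hs
      simp only [Set.Icc.coe_one, Set.Icc.coe_zero, add_zero, Int.floor_add_one,
        Int.fract_add_one, zpow_add_one]
      rfl)

theorem suspensionFlow_zero (g : W ≃ₜ W) (y : Suspension g) : suspensionFlow g 0 y = y := by
  induction y using Quot.ind with
  | mk p =>
    obtain ⟨x, s, hs0, hs1⟩ := p
    rcases hs1.lt_or_eq with h | rfl
    · have h1 : ⌊s⌋ = 0 := Int.floor_eq_zero_iff.2 ⟨hs0, h⟩
      have h2 : Int.fract s = s := Int.fract_eq_self.2 ⟨hs0, h⟩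
      simp only [suspensionFlow, zero_add, h1, h2, zpow_zero]
      rfl
    · refine Eq.symm (Quot.sound ⟨rfl, ?_⟩)
      simp

theorem suspensionFlow_add (g : W ≃ₜ W) (t s : ℝ) (y : Suspension g) :
    suspensionFlow g (t + s) y = suspensionFlow g t (suspensionFlow g s y) := by
  induction y using Quot.ind with
  | mk p =>
    obtain ⟨x, σ, hσ⟩ := p
    have h : t + s + σ = t + Int.fract (s + σ) + (⌊s + σ⌋ : ℤ) := by
      have := Int.floor_add_fract (s + σ)
      linarith
    simp only [suspensionFlow, h, Int.floor_add_intCast, Int.fract_add_intCast, zpow_add]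
    rfl

/-- The time `τ` map of the suspension flow as a bijection, so that its integer powers are
defined. -/
def timeMap (g : W ≃ₜ W) (τ : ℝ) : Equiv.Perm (Suspension g) where
  toFun := suspensionFlow g τ
  invFun := suspensionFlow g (-τ)
  left_inv y := by rw [← suspensionFlow_add, neg_add_cancel, suspensionFlow_zero]
  right_inv y := by rw [← suspensionFlow_add, add_neg_cancel, suspensionFlow_zero]

/-- The point `(x, 0)` of the suspension. -/
def basePoint (g : W ≃ₜ W) (x : W) : Suspension g := Quot.mk _ (x, 0)

/-- For a `g`-invariant set `B` and `r : B → A` with `r ∘ g = r`, the partial map from the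
suspension to `A` induced by `r`: it sends `(x, s)` to `r x` if `x ∈ B`, and is undefined (`none`)
outside the image of `B × [0,1]`. -/
def suspendedMap {A : Type*} (g : W ≃ₜ W) (B : Set W) (r : B → A) (hB : g '' B = B)
    (hr : ∀ b b' : B, (b' : W) = g b → r b' = r b) : Suspension g → Option A := by
  classical
  exact Quot.lift (fun p => if h : p.1 ∈ B then some (r ⟨p.1, h⟩) else none) (by
    rintro ⟨x, s⟩ q ⟨-, rfl⟩
    have hx : g x ∈ B ↔ x ∈ B := by
      conv_lhs => rw [← hB]
      exact g.injective.mem_set_image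
    by_cases h : x ∈ B
    · simp only [h, hx.2 h, dif_pos]
      exact congrArg some (hr ⟨x, h⟩ ⟨g x, hx.2 h⟩ rfl).symm
    · simp only [h, mt hx.1 h, dif_neg, not_false_eq_true])

end Suspension

/-! ### The almost one-to-one extension and its quotient -/

section Extension

variable {Y : Type*} [TopologicalSpace Y]

/-- The function `u' = ∑ₙ aₙ · (u ∘ fⁿ)`, meaningful off the full orbit of the
point where `u` is undefined. -/
def orbitAverage (f : Equiv.Perm Y) (a : ℤ → ℝ) (u : Y → ℝ) (y : Y) : ℝ :=
  ∑' n : ℤ, a n * u ((f ^ n) y)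

/-- The graph of `u'` over the complement of the full `f`-orbit of `y₀`, as a subset of
`Y × [0,1]`. -/
def averageGraph (f : Equiv.Perm Y) (y₀ : Y) (a : ℤ → ℝ) (u : Y → ℝ) :
    Set (Y × unitInterval) :=
  {p | (∀ n : ℤ, (f ^ n) y₀ ≠ p.1) ∧ (p.2 : ℝ) = orbitAverage f a u p.1}

/-- The space `X`: the closure of the graph of `u'` in `Y × [0,1]`. -/
abbrev ExtensionSpace (f : Equiv.Perm Y) (y₀ : Y) (a : ℤ → ℝ) (u : Y → ℝ) : Type _ :=
  closure (averageGraph f y₀ a u)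

/-- `h` extends the homeomorphism `f' = π⁻¹ ∘ f ∘ π` of the graph of `u'`, where `π` is the
first coordinate projection: points of the graph go to the point of the graph above the
image under `f` of their projection. -/
def ExtendsGraphMap (f : Equiv.Perm Y) (y₀ : Y) (a : ℤ → ℝ) (u : Y → ℝ)
    (h : ExtensionSpace f y₀ a u ≃ₜ ExtensionSpace f y₀ a u) : Prop :=
  ∀ x : ExtensionSpace f y₀ a u, x.1 ∈ averageGraph f y₀ a u →
    (h x).1 ∈ averageGraph f y₀ a u ∧ (h x).1.1 = f x.1.1

/-- The equivalence relation on `X` which, for a partial map `ρ` from `Y` to `A`, identifies two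
points when they are equal or when `ρ ∘ π` is defined and takes the same value at both. -/
def collapseSetoid {A : Type*} (f : Equiv.Perm Y) (y₀ : Y) (a : ℤ → ℝ) (u : Y → ℝ)
    (ρ : Y → Option A) : Setoid (ExtensionSpace f y₀ a u) where
  r x x' := x = x' ∨ ∃ c : A, ρ x.1.1 = some c ∧ ρ x'.1.1 = some c
  iseqv := by
    refine ⟨fun x => Or.inl rfl, ?_, ?_⟩
    · rintro x x' (rfl | ⟨c, h, h'⟩)
      · exact Or.inl rfl
      · exact Or.inr ⟨c, h', h⟩
    · rintro x x' x'' (rfl | ⟨c, h, h'⟩) (rfl | ⟨d, k, k'⟩)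
      · exact Or.inl rfl
      · exact Or.inr ⟨d, k, k'⟩
      · exact Or.inr ⟨c, h, h'⟩
      · obtain rfl : c = d := Option.some.inj (h'.symm.trans k)
        exact Or.inr ⟨c, h, k'⟩

/-- The quotient of `X` by the equivalence relation above, with the quotient topology. -/
abbrev CollapsedSpace {A : Type*} (f : Equiv.Perm Y) (y₀ : Y) (a : ℤ → ℝ) (u : Y → ℝ)
    (ρ : Y → Option A) : Type _ :=
  Quotient (collapseSetoid f y₀ a u ρ)

end Extension

end

/-! The space `X` is modelled by the closure of the itinerary graph `y ↦ (u(fⁿ y))ₙ` in `Y ×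
[0,1]^ℤ`. Taking weighted sums maps this model homeomorphically onto `X`
(`OscillatingFlow.extensionHomeo`), because over `fᵐ(y₀)` only the coordinate `-m` is free and its
weight is positive. In the model, `f` lifts to the shift.

Rigidity comes from path components. As `W` is totally disconnected, paths in `Y` follow flow lines
(`exists_flow_param`). In `X` the flow line of `y₀` is broken at each time `mτ`: one coordinate
tends to `0` from the left but oscillates over `[0,1]` from the right, as in the topologist's sine
curve, and no path crosses (`not_crossing`). The pieces over `(mτ, (m+1)τ]`, the strands, are path
components. Since `x₀ ∉ B`, the strands and their closures miss the collapsed set, so they remain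
path components in `X_r` (`IsCollapse.pathComponent_eq_strand`).

A homeomorphism `k` of `X_r` permutes path components, and it maps strands to strands
(`exists_mem_strand_of_mem_image`). Otherwise `k⁻¹` carries a compact arc of length `τ` of another
flow line into an arc of some strand shorter than `τ`. It then carries a whole strand close to the
first arc into a thin neighbourhood of the second one, which is too short to contain a path
component.

The frontier of each strand lies in the preceding strand, so `k` shifts the indices by a constant
`c`, and `h_r^(-c) k` preserves each strand and its frontier. Each frontier lies in one fibre, and
such fibres shrink to every point off the orbit of `y₀`, so `h_r^(-c) k` is the identity. The same
shrinking of fibres deduces transitivity of `h_r^n` from that of `y₀`. -/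

noncomputable section

/-! ### Topology of the suspension -/

section SuspensionTopology

variable {W : Type*} [TopologicalSpace W]

/-- The point reached from `(x, 0)` after flowing for time `t`. -/
def flowChart (g : W ≃ₜ W) (p : W × ℝ) : Suspension g :=
  Quot.mk (SuspensionRel g)
    ((g ^ ⌊p.2⌋ : W ≃ₜ W) p.1, ⟨Int.fract p.2, Int.fract_nonneg _, (Int.fract_lt_one _).le⟩)

theorem suspension_glue (g : W ≃ₜ W) (x : W) :
    (Quot.mk (SuspensionRel g) (x, 1) : Suspension g) = Quot.mk _ (g x, 0) :=
  Quot.sound ⟨rfl, rfl⟩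

theorem mk_eq_flowChart (g : W ≃ₜ W) (x : W) (s : unitInterval) :
    (Quot.mk (SuspensionRel g) (x, s) : Suspension g) = flowChart g (x, (s : ℝ)) := by
  have h := suspensionFlow_zero g (Quot.mk (SuspensionRel g) (x, s))
  rw [← h]
  simp only [suspensionFlow, zero_add, flowChart]

theorem flowChart_int_add (g : W ≃ₜ W) (x : W) (t : ℝ) (m : ℤ) :
    flowChart g (x, t + m) = flowChart g ((g ^ m : W ≃ₜ W) x, t) := by
  simp only [flowChart, Int.floor_add_intCast, Int.fract_add_intCast, zpow_add]
  rfl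

theorem suspensionFlow_flowChart (g : W ≃ₜ W) (x : W) (s t : ℝ) :
    suspensionFlow g s (flowChart g (x, t)) = flowChart g (x, s + t) := by
  have h : s + t = s + Int.fract t + (⌊t⌋ : ℤ) := by
    have := Int.floor_add_fract t
    linarith
  rw [h, flowChart_int_add]
  rfl

theorem suspensionFlow_basePoint (g : W ≃ₜ W) (x : W) (t : ℝ) :
    suspensionFlow g t (basePoint g x) = flowChart g (x, t) := by
  have h : basePoint g x = flowChart g (x, 0) := mk_eq_flowChart g x 0
  rw [h, suspensionFlow_flowChart, add_zero]

theorem flowChart_surjective (g : W ≃ₜ W) : Function.Surjective (flowChart g) := by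
  intro y
  induction y using Quot.ind with
  | mk p => exact ⟨_, (mk_eq_flowChart g p.1 p.2).symm⟩

/-- `SuspensionRel` only generates the gluing relation. The normal form `N`, which moves height `1`
to height `0`, respects it and separates points below height `1`. -/
theorem mk_injective_of_lt (g : W ≃ₜ W) {p q : W × unitInterval} (hp : p.2 ≠ 1) (hq : q.2 ≠ 1)
    (h : (Quot.mk (SuspensionRel g) p : Suspension g) = Quot.mk _ q) : p = q := by
  classical
  let N : Suspension g → W × unitInterval :=
    Quot.lift (fun p => if p.2 = 1 then (g p.1, 0) else p) (by
      rintro ⟨x, s⟩ q ⟨hs, rfl⟩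
      simp only at hs
      simp [hs])
  have h' : N (Quot.mk _ p) = N (Quot.mk _ q) := congrArg N h
  simpa [N, hp, hq] using h'

theorem flowChart_eq_iff (g : W ≃ₜ W) (p q : W × ℝ) :
    flowChart g p = flowChart g q ↔ ∃ m : ℤ, p = ((g ^ m : W ≃ₜ W) q.1, q.2 - m) := by
  obtain ⟨x, t⟩ := p
  obtain ⟨x', t'⟩ := q
  constructor
  · intro h
    have h1 : ∀ t : ℝ, (⟨Int.fract t, Int.fract_nonneg _, (Int.fract_lt_one _).le⟩ :
        unitInterval) ≠ 1 := fun t ht =>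
      (Int.fract_lt_one t).ne (congrArg Subtype.val ht)
    have h2 := mk_injective_of_lt g (h1 t) (h1 t') h
    simp only [Prod.mk.injEq] at h2
    have h4 : Int.fract t = Int.fract t' := congrArg Subtype.val h2.2
    refine ⟨⌊t'⌋ - ⌊t⌋, Prod.ext ?_ ?_⟩
    · have h3 : (g ^ ⌊t⌋ : W ≃ₜ W) ((g ^ (⌊t'⌋ - ⌊t⌋) : W ≃ₜ W) x') = (g ^ ⌊t'⌋ : W ≃ₜ W) x' := by
        change (g ^ ⌊t⌋ * g ^ (⌊t'⌋ - ⌊t⌋) : W ≃ₜ W) x' = _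
        rw [← zpow_add, add_sub_cancel]
      exact (g ^ ⌊t⌋ : W ≃ₜ W).injective (h2.1.trans h3.symm)
    · have := Int.floor_add_fract t
      have := Int.floor_add_fract t'
      push_cast
      linarith
  · rintro ⟨m, hm⟩
    rw [hm, ← flowChart_int_add, sub_add_cancel]

theorem continuousOn_flowChart_strip (g : W ≃ₜ W) (m : ℤ) :
    ContinuousOn (flowChart g) (univ ×ˢ Icc (m : ℝ) (m + 1)) := by
  have h : EqOn (flowChart g) (fun p => Quot.mk (SuspensionRel g)
      ((g ^ m : W ≃ₜ W) p.1, projIcc (0 : ℝ) 1 zero_le_one (p.2 - m)))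
      (univ ×ˢ Icc (m : ℝ) (m + 1)) := by
    rintro ⟨x, t⟩ ⟨-, ht⟩
    simp only
    rw [mk_eq_flowChart, projIcc_of_mem zero_le_one (x := t - m)
      ⟨by linarith [ht.1], by linarith [ht.2]⟩, ← flowChart_int_add]
    simp
  refine ContinuousOn.congr (Continuous.continuousOn ?_) h
  refine continuous_quot_mk.comp (Continuous.prodMk ?_ ?_)
  · exact (g ^ m : W ≃ₜ W).continuous.comp continuous_fst
  · exact continuous_projIcc.comp (continuous_snd.sub continuous_const)

theorem continuous_flowChart (g : W ≃ₜ W) : Continuous (flowChart g) := by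
  rw [continuous_iff_continuousAt]
  rintro ⟨x, t⟩
  set m := ⌊t⌋
  have h1 := continuousOn_flowChart_strip g (m - 1)
  have h2 := continuousOn_flowChart_strip g m
  have h3 := h1.union_of_isClosed h2 (isClosed_univ.prod isClosed_Icc)
    (isClosed_univ.prod isClosed_Icc)
  refine h3.continuousAt ?_
  have hm : t ∈ Ioo ((m : ℝ) - 1) (m + 1) :=
    ⟨by linarith [Int.floor_le t], Int.lt_floor_add_one t⟩
  filter_upwards [(isOpen_univ.prod isOpen_Ioo).mem_nhds (show (x, t) ∈ univ ×ˢ _ from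
    ⟨mem_univ _, hm⟩)]
  rintro ⟨x', t'⟩ ⟨-, ht1, ht2⟩
  simp only [mem_union, mem_prod, mem_univ, true_and, mem_Icc]
  rcases le_total t' m with h | h
  · left
    push_cast
    exact ⟨ht1.le, by linarith⟩
  · exact Or.inr ⟨h, ht2.le⟩

theorem isOpenMap_flowChart (g : W ≃ₜ W) : IsOpenMap (flowChart g) := by
  intro O hO
  rw [← isQuotientMap_quot_mk.isOpen_preimage]
  have h : (Quot.mk (SuspensionRel g)) ⁻¹' (flowChart g '' O) =
      ⋃ m : ℤ, (fun p : W × unitInterval => ((g ^ m : W ≃ₜ W) p.1, (p.2 : ℝ) - m)) ⁻¹' O := by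
    ext ⟨x, s⟩
    simp only [mem_preimage, mem_image, mem_iUnion]
    constructor
    · rintro ⟨q, hq, h⟩
      rw [mk_eq_flowChart, flowChart_eq_iff] at h
      obtain ⟨m, rfl⟩ := h
      exact ⟨m, hq⟩
    · rintro ⟨m, hm⟩
      exact ⟨_, hm, by rw [mk_eq_flowChart, flowChart_eq_iff]; exact ⟨m, rfl⟩⟩
  rw [h]
  refine isOpen_iUnion fun m => hO.preimage ?_
  refine Continuous.prodMk ((g ^ m : W ≃ₜ W).continuous.comp continuous_fst) ?_
  exact (continuous_subtype_val.comp continuous_snd).sub continuous_const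

theorem isOpenQuotientMap_flowChart (g : W ≃ₜ W) : IsOpenQuotientMap (flowChart g) :=
  ⟨flowChart_surjective g, continuous_flowChart g, isOpenMap_flowChart g⟩

theorem t2Space_suspension [T2Space W] (g : W ≃ₜ W) : T2Space (Suspension g) := by
  rw [t2Space_iff_of_isOpenQuotientMap (isOpenQuotientMap_flowChart g)]
  simp_rw [flowChart_eq_iff]
  refine isClosed_of_closure_subset fun q hq => ?_
  -- The relation is a union of closed sets, one for each integer `j`. Where the difference of the
  -- times is within `2/3` of `m`, only `j = m` occurs, so the union is locally finite.
  set m : ℤ := round (q.2.2 - q.1.2) with hm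
  have hO : IsOpen {q : (W × ℝ) × (W × ℝ) | |q.2.2 - q.1.2 - m| < 2 / 3} :=
    isOpen_lt (by fun_prop) continuous_const
  have hqO : q ∈ {q : (W × ℝ) × (W × ℝ) | |q.2.2 - q.1.2 - m| < 2 / 3} := by
    have := abs_sub_round (q.2.2 - q.1.2)
    exact this.trans_lt (by norm_num)
  have hsub : closure {q : (W × ℝ) × (W × ℝ) |
      ∃ m : ℤ, q.1 = ((g ^ m : W ≃ₜ W) q.2.1, q.2.2 - m)} ∩
      {q : (W × ℝ) × (W × ℝ) | |q.2.2 - q.1.2 - m| < 2 / 3} ⊆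
      closure (⋃ j ∈ ({m - 1, m, m + 1} : Set ℤ), {q : (W × ℝ) × (W × ℝ) |
        q.1 = ((g ^ j : W ≃ₜ W) q.2.1, q.2.2 - j)}) := by
    rw [inter_comm]
    refine hO.inter_closure.trans (closure_mono ?_)
    rintro p ⟨hp1, j, hj⟩
    have hj2 := congrArg Prod.snd hj
    simp only [mem_ofPred_eq] at hp1 hj2
    rw [hj2] at hp1
    have h1 : |((j - m : ℤ) : ℝ)| < 1 := by
      push_cast
      calc |(j : ℝ) - m| = |p.2.2 - (p.2.2 - j) - m| := by congr 1; ring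
        _ < 1 := hp1.trans (by norm_num)
    have h2 : |j - m| < 1 := by exact_mod_cast h1
    have h3 : j = m := by
      have := Int.abs_lt_one_iff.1 h2
      omega
    simp only [mem_iUnion]
    exact ⟨j, by simp [h3], hj⟩
  have hcl : IsClosed (⋃ j ∈ ({m - 1, m, m + 1} : Set ℤ), {q : (W × ℝ) × (W × ℝ) |
        q.1 = ((g ^ j : W ≃ₜ W) q.2.1, q.2.2 - j)}) := by
    refine Set.Finite.isClosed_biUnion (by simp) fun j _ => ?_
    have := (g ^ j : W ≃ₜ W).continuous
    exact isClosed_eq (by fun_prop) (by fun_prop)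
  have := hsub ⟨hq, hqO⟩
  rw [hcl.closure_eq] at this
  simp only [mem_iUnion] at this
  obtain ⟨j, -, hj⟩ := this
  exact ⟨j, hj⟩

/-- The suspension flow as a continuous action of `ℝ`. -/
def suspFlow (g : W ≃ₜ W) : Flow ℝ (Suspension g) where
  toFun := suspensionFlow g
  cont' := by
    have h : IsOpenQuotientMap (Prod.map (id : ℝ → ℝ) (flowChart g)) :=
      IsOpenQuotientMap.id.prodMap (isOpenQuotientMap_flowChart g)
    rw [h.isQuotientMap.continuous_iff]
    have h2 : Function.uncurry (suspensionFlow g) ∘ Prod.map (id : ℝ → ℝ) (flowChart g) =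
        fun q => flowChart g (q.2.1, q.1 + q.2.2) := by
      ext ⟨s, x, t⟩
      exact suspensionFlow_flowChart g x s t
    rw [h2]
    exact (continuous_flowChart g).comp (by fun_prop)
  map_add' := suspensionFlow_add g
  map_zero' := suspensionFlow_zero g

theorem isCoveringMap_flowChart (g : W ≃ₜ W) : IsCoveringMap (flowChart g) := by
  let _ : AddAction ℤ (W × ℝ) :=
    { vadd := fun m p => ((g ^ m : W ≃ₜ W) p.1, p.2 - m)
      zero_vadd := fun p => by
        change ((g ^ (0 : ℤ) : W ≃ₜ W) p.1, p.2 - ((0 : ℤ) : ℝ)) = p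
        simp
      add_vadd := fun m n p => by
        change ((g ^ (m + n) : W ≃ₜ W) p.1, p.2 - ((m + n : ℤ) : ℝ)) =
          ((g ^ m : W ≃ₜ W) ((g ^ n : W ≃ₜ W) p.1), p.2 - (n : ℝ) - (m : ℝ))
        rw [zpow_add]
        refine Prod.ext rfl ?_
        push_cast
        ring }
  have hv : ∀ (m : ℤ) (p : W × ℝ), m +ᵥ p = ((g ^ m : W ≃ₜ W) p.1, p.2 - m) := fun _ _ => rfl
  have h : IsAddQuotientCoveringMap (flowChart g) ℤ :=
    { toIsQuotientMap := (isOpenQuotientMap_flowChart g).isQuotientMap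
      continuous_const_vadd := fun m => by
        have := (g ^ m : W ≃ₜ W).continuous
        simp only [hv]
        fun_prop
      apply_eq_iff_mem_orbit := by
        intro p q
        rw [flowChart_eq_iff, AddAction.mem_orbit_iff]
        simp only [hv, eq_comm]
      disjoint := by
        intro p
        -- Two times within `1/2` of `p.2` differ by less than `1`, so no nonzero integer
        -- translation returns to this neighbourhood.
        refine ⟨{q | |q.2 - p.2| < 1 / 2},
          (isOpen_lt (by fun_prop) continuous_const).mem_nhds (by simp), ?_⟩
        rintro m ⟨q, ⟨q', hq', rfl⟩, hq⟩
        simp only [hv, mem_ofPred_eq] at hq hq'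
        have h1 : |((m : ℤ) : ℝ)| < 1 := by
          rw [abs_lt] at hq hq' ⊢
          constructor <;> linarith [hq.1, hq.2, hq'.1, hq'.2]
        have h2 : |m| < 1 := by exact_mod_cast h1
        exact Int.abs_lt_one_iff.1 h2 }
  exact h.isCoveringMap

/-- Paths in the suspension of a homeomorphism of a totally disconnected space run along
flow lines. -/
theorem exists_flow_param [TotallyDisconnectedSpace W] (g : W ≃ₜ W)
    (γ : C(unitInterval, Suspension g)) :
    ∃ θ : C(unitInterval, ℝ), θ 0 = 0 ∧ ∀ t, γ t = suspFlow g (θ t) (γ 0) := by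
  obtain ⟨⟨x, t₀⟩, hx⟩ := flowChart_surjective g (γ 0)
  have cov := isCoveringMap_flowChart g
  set Γ := cov.liftPath γ (x, t₀) hx.symm
  have h1 : ∀ t, flowChart g (Γ t) = γ t := fun t => congrFun (cov.liftPath_lifts γ _ hx.symm) t
  have h0 : Γ 0 = (x, t₀) := cov.liftPath_zero γ _ hx.symm
  -- The first coordinate of the lifted path is constant, because `W` is totally disconnected.
  have hc : ∀ t, (Γ t).1 = x := by
    intro t
    have h2 := (isPreconnected_range (continuous_fst.comp Γ.continuous)).subsingleton
      (mem_range_self t) (mem_range_self 0)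
    simpa [h0] using h2
  refine ⟨⟨fun t => (Γ t).2 - t₀, by fun_prop⟩, by simp [h0], fun t => ?_⟩
  have h2 : suspFlow g ((Γ t).2 - t₀) (flowChart g (x, t₀)) = flowChart g (Γ t) := by
    refine (suspensionFlow_flowChart g x _ _).trans (congrArg _ ?_)
    exact Prod.ext (hc t).symm (by simp)
  rw [hx, h1] at h2
  exact h2.symm

/-- A period would make `x₀` a fixed point of some `gᵐ` with `m ≠ 0`, and a fixed point has a
one-point orbit closure. -/
theorem suspFlow_basePoint_injective [T1Space W] [Nontrivial W] (g : W ≃ₜ W) (x₀ : W)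
    (hx₀ : ∀ n : ℤ, n ≠ 0 → IsTransitivePoint (g ^ n : W ≃ₜ W) x₀) :
    Function.Injective fun t => suspFlow g t (basePoint g x₀) := by
  intro s t hst
  replace hst : suspensionFlow g s (basePoint g x₀) = suspensionFlow g t (basePoint g x₀) := hst
  rw [suspensionFlow_basePoint, suspensionFlow_basePoint, flowChart_eq_iff] at hst
  obtain ⟨m, hm⟩ := hst
  simp only [Prod.mk.injEq] at hm
  by_cases h : m = 0
  · simpa [h] using hm.2
  · have h1 := hx₀ m h
    have h2 : {y | ∃ k : ℕ, 1 ≤ k ∧ y = (⇑(g ^ m : W ≃ₜ W))^[k] x₀} ⊆ {x₀} := by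
      rintro y ⟨k, -, rfl⟩
      exact Function.iterate_fixed hm.1.symm k
    have h3 := closure_mono h2
    rw [closure_singleton, show closure {y | ∃ k : ℕ, 1 ≤ k ∧ y = (⇑(g ^ m : W ≃ₜ W))^[k] x₀} =
      univ from h1] at h3
    obtain ⟨y, hy⟩ := exists_ne x₀
    exact (hy (h3 (mem_univ y))).elim

theorem timeMap_zpow (g : W ≃ₜ W) (τ : ℝ) (n : ℤ) (y : Suspension g) :
    (timeMap g τ ^ n) y = suspFlow g (n * τ) y := by
  have hs : ∀ y, timeMap g τ y = suspFlow g τ y := fun _ => rfl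
  have hs' : ∀ y, (timeMap g τ)⁻¹ y = suspFlow g (-τ) y := fun _ => rfl
  induction n generalizing y with
  | zero => simp
  | succ n ih =>
    rw [zpow_add_one, Equiv.Perm.mul_apply, ih, hs, ← Flow.map_add]
    congr 1
    push_cast
    ring
  | pred n ih =>
    rw [zpow_sub_one, Equiv.Perm.mul_apply, ih, hs', ← Flow.map_add]
    congr 1
    push_cast
    ring

theorem suspendedMap_suspFlow {A : Type*} (g : W ≃ₜ W) (B : Set W) (r : B → A) (hB : g '' B = B)
    (hr : ∀ b b' : B, (b' : W) = g b → r b' = r b) (t : ℝ) (y : Suspension g) :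
    suspendedMap g B r hB hr (suspFlow g t y) = suspendedMap g B r hB hr y := by
  have h1 : ∀ x s, suspendedMap g B r hB hr (Quot.mk _ (x, s)) =
    suspendedMap g B r hB hr (basePoint g x) := fun _ _ => rfl
  have h2 : ∀ x, suspendedMap g B r hB hr (basePoint g (g x)) =
      suspendedMap g B r hB hr (basePoint g x) := fun x =>
    (congrArg (suspendedMap g B r hB hr) (suspension_glue g x)).symm.trans (h1 x 1)
  have h3 : ∀ (n : ℤ) x, suspendedMap g B r hB hr (basePoint g ((g ^ n : W ≃ₜ W) x)) =
      suspendedMap g B r hB hr (basePoint g x) := by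
    intro n
    induction n with
    | zero => simp
    | succ n ih =>
      intro x
      rw [zpow_add_one]
      exact (ih (g x)).trans (h2 x)
    | pred n ih =>
      intro x
      rw [zpow_sub_one]
      refine (ih (g⁻¹ x)).trans ((h2 _).symm.trans ?_)
      rw [show g (g⁻¹ x) = x from g.apply_symm_apply x]
  induction y using Quot.ind with
  | mk p => exact h3 _ _

theorem isClosed_suspendedMap_rel [CompactSpace W] [T2Space W] {A : Type*} [TopologicalSpace A]
    [T2Space A] (g : W ≃ₜ W) (B : Set W) (hB_closed : IsClosed B) (r : B → A)
    (hr_cont : Continuous r) (hB : g '' B = B)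
    (hr : ∀ b b' : B, (b' : W) = g b → r b' = r b) :
    IsClosed {q : Suspension g × Suspension g | ∃ c, suspendedMap g B r hB hr q.1 = some c ∧
      suspendedMap g B r hB hr q.2 = some c} := by
  have := t2Space_suspension g
  have : CompactSpace B := isCompact_iff_compactSpace.1 hB_closed.isCompact
  let F : (B × unitInterval) × (B × unitInterval) → Suspension g × Suspension g := fun q =>
    (Quot.mk _ ((q.1.1 : W), q.1.2), Quot.mk _ ((q.2.1 : W), q.2.2))
  have hF : Continuous F := by
    refine Continuous.prodMk ?_ ?_ <;> refine continuous_quot_mk.comp ?_ <;> fun_prop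
  have hK : IsClosed {q : (B × unitInterval) × (B × unitInterval) | r q.1.1 = r q.2.1} :=
    isClosed_eq (by fun_prop) (by fun_prop)
  convert (hK.isCompact.image hF).isClosed
  ext ⟨y, y'⟩
  obtain ⟨⟨x, s⟩, rfl⟩ := Quot.exists_rep y
  obtain ⟨⟨x', s'⟩, rfl⟩ := Quot.exists_rep y'
  constructor
  · rintro ⟨c, h, h'⟩
    simp only [suspendedMap] at h h'
    split_ifs at h with hx
    split_ifs at h' with hx'
    refine ⟨((⟨x, hx⟩, s), (⟨x', hx'⟩, s')), ?_, rfl⟩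
    exact (Option.some.inj h).trans (Option.some.inj h').symm
  · rintro ⟨⟨⟨b, σ⟩, ⟨b', σ'⟩⟩, hq, h⟩
    have h1 : ∀ (b : B) σ, suspendedMap g B r hB hr (Quot.mk _ ((b : W), σ)) = some (r b) := by
      intro b σ
      simp [suspendedMap]
    rw [← h]
    exact ⟨r b, h1 b σ, (h1 b' σ').trans (congrArg some hq.symm)⟩

theorem suspendedMap_basePoint_of_transitive {A : Type*} (g : W ≃ₜ W) (B : Set W)
    (hB_closed : IsClosed B) (hB_ne : B ≠ univ) (r : B → A) (hB : g '' B = B)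
    (hr : ∀ b b' : B, (b' : W) = g b → r b' = r b) {x₀ : W} (hx₀ : IsTransitivePoint g x₀) :
    suspendedMap g B r hB hr (basePoint g x₀) = none := by
  have h : x₀ ∉ B := by
    intro h
    have h1 : ∀ k : ℕ, g^[k] x₀ ∈ B := by
      intro k
      induction k with
      | zero => exact h
      | succ k ih =>
        rw [Function.iterate_succ_apply', ← hB]
        exact mem_image_of_mem _ ih
    have h2 : closure {y | ∃ k : ℕ, 1 ≤ k ∧ y = g^[k] x₀} ⊆ B := by
      refine closure_minimal ?_ hB_closed
      rintro y ⟨k, -, rfl⟩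
      exact h1 k
    rw [show closure {y | ∃ k : ℕ, 1 ≤ k ∧ y = g^[k] x₀} = univ from hx₀] at h2
    exact hB_ne (univ_subset_iff.1 h2)
  simp [suspendedMap, basePoint, h]

end SuspensionTopology


/-! ### Itineraries along a flow -/

section Itinerary

variable {Y : Type*} [TopologicalSpace Y]

/-- The points `y` off the orbit of `y₀` under the time `τ` map, together with the sequence of
values of `v` along the orbit of `y`. -/
def itineraryGraph (φ : Flow ℝ Y) (τ : ℝ) (y₀ : Y) (v : Y → unitInterval) :
    Set (Y × (ℤ → unitInterval)) :=
  {p | (∀ n : ℤ, p.1 ≠ φ (n * τ) y₀) ∧ ∀ n : ℤ, p.2 n = v (φ (n * τ) p.1)}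

/-- The closure of the itinerary graph. -/
abbrev ItinerarySpace (φ : Flow ℝ Y) (τ : ℝ) (y₀ : Y) (v : Y → unitInterval) : Type _ :=
  closure (itineraryGraph φ τ y₀ v)

/-- A flow with a free orbit through `y₀`, dense under the time `τ` map, whose paths run along
flow lines, and a function `v` which is continuous except at `y₀`, vanishes on the flow line of
`y₀` just before `y₀` and takes all values just after `y₀`. -/
structure OscillatingFlow (φ : Flow ℝ Y) (τ : ℝ) (y₀ : Y) (v : Y → unitInterval) : Prop where
  pos : 0 < τ
  inj : Function.Injective fun t => φ t y₀
  cont : ContinuousOn v {y₀}ᶜ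
  neg : ∀ t ∈ Ico (-(1 / 2) : ℝ) 0, v (φ t y₀) = 0
  osc : ∀ s : unitInterval, ∀ ε > 0, ∃ t ∈ Ioo (0 : ℝ) ε, v (φ t y₀) = s
  lift : ∀ γ : C(unitInterval, Y), ∃ θ : C(unitInterval, ℝ), θ 0 = 0 ∧
    ∀ t, γ t = φ (θ t) (γ 0)
  dense : ∀ N : ℤ, Dense {y | ∃ n : ℤ, N ≤ n ∧ y = φ (n * τ) y₀}

variable {φ : Flow ℝ Y} {τ : ℝ} {y₀ : Y} {v : Y → unitInterval}

theorem Flow.apply_eq_iff_neg (φ : Flow ℝ Y) (t : ℝ) (y z : Y) : φ t y = z ↔ y = φ (-t) z := by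
  constructor
  · rintro rfl
    rw [← Flow.map_add, neg_add_cancel, Flow.map_zero_apply]
  · rintro rfl
    rw [← Flow.map_add, add_neg_cancel, Flow.map_zero_apply]

theorem ne_zpow_mul_iff (y : Y) :
    (∀ n : ℤ, y ≠ φ (n * τ) y₀) ↔ ∀ n : ℤ, φ (n * τ) y ≠ y₀ := by
  constructor
  · intro h n hn
    rw [Flow.apply_eq_iff_neg] at hn
    exact h (-n) (by rw [hn]; congr 1; push_cast; ring)
  · intro h n hn
    refine h (-n) ?_
    rw [Flow.apply_eq_iff_neg, hn]
    congr 1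
    push_cast
    ring

theorem mk_mem_closure_itineraryGraph {y : Y} (h : ∀ n : ℤ, y ≠ φ (n * τ) y₀) :
    (y, fun n : ℤ => v (φ (n * τ) y)) ∈ closure (itineraryGraph φ τ y₀ v) :=
  subset_closure ⟨h, fun _ => rfl⟩

theorem dense_itinerary_off_orbit :
    Dense {x : ItinerarySpace φ τ y₀ v | ∀ n : ℤ, x.1.1 ≠ φ (n * τ) y₀} := by
  intro x
  rw [closure_subtype]
  refine closure_mono ?_ x.2
  intro p hp
  exact ⟨⟨p, subset_closure hp⟩, hp.1, rfl⟩

namespace OscillatingFlow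

variable (H : OscillatingFlow φ τ y₀ v)
include H

theorem eq_of_apply_eq {s t : ℝ} (h : φ s y₀ = φ t y₀) : s = t := H.inj h

theorem apply_ne {t : ℝ} (h : t ≠ 0) : φ t y₀ ≠ y₀ := fun h1 =>
  h (H.eq_of_apply_eq (h1.trans (φ.map_zero_apply y₀).symm))

/-- The equation defining the graph passes to the closure wherever `v` is evaluated at a point of
continuity. -/
theorem coord_eq [T2Space Y] (x : ItinerarySpace φ τ y₀ v) (n : ℤ) (h : φ (n * τ) x.1.1 ≠ y₀) :
    x.1.2 n = v (φ (n * τ) x.1.1) := by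
  have : (𝓝[itineraryGraph φ τ y₀ v] x.1).NeBot := mem_closure_iff_nhdsWithin_neBot.1 x.2
  have h1 : ContinuousAt (fun p : Y × (ℤ → unitInterval) => v (φ (n * τ) p.1)) x.1 :=
    ContinuousAt.comp (f := fun p : Y × (ℤ → unitInterval) => φ (n * τ) p.1) (g := v)
      (H.cont.continuousAt (isOpen_compl_singleton.mem_nhds h))
      (by fun_prop)
  have h2 : ContinuousAt (fun p : Y × (ℤ → unitInterval) => p.2 n) x.1 := by fun_prop
  refine tendsto_nhds_unique_of_eventuallyEq (l := 𝓝[itineraryGraph φ τ y₀ v] x.1) (h2.mono_left nhdsWithin_le_nhds)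
    (h1.mono_left nhdsWithin_le_nhds) ?_
  filter_upwards [self_mem_nhdsWithin] with p hp
  exact hp.2 n

theorem mem_itineraryGraph [T2Space Y] (x : ItinerarySpace φ τ y₀ v)
    (h : ∀ n : ℤ, x.1.1 ≠ φ (n * τ) y₀) : x.1 ∈ itineraryGraph φ τ y₀ v :=
  ⟨h, fun n => H.coord_eq x n ((ne_zpow_mul_iff _).1 h n)⟩

theorem ext_off_orbit [T2Space Y] {x x' : ItinerarySpace φ τ y₀ v} (h : x.1.1 = x'.1.1)
    (ho : ∀ n : ℤ, x.1.1 ≠ φ (n * τ) y₀) : x = x' := by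
  refine Subtype.ext (Prod.ext h (funext fun n => ?_))
  rw [(H.mem_itineraryGraph x ho).2, (H.mem_itineraryGraph x' (h ▸ ho)).2, h]

/-- Over time `mτ` only the coordinate `-m` reads `v` at its discontinuity. -/
theorem ext_on_orbit [T2Space Y] {x x' : ItinerarySpace φ τ y₀ v} {m : ℤ}
    (h : x.1.1 = φ (m * τ) y₀) (h' : x'.1.1 = φ (m * τ) y₀) (hs : x.1.2 (-m) = x'.1.2 (-m)) :
    x = x' := by
  refine Subtype.ext (Prod.ext (h.trans h'.symm) (funext fun n => ?_))
  by_cases hn : n = -m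
  · rw [hn, hs]
  · have h1 : φ (n * τ) (φ (m * τ) y₀) ≠ y₀ := by
      rw [← Flow.map_add]
      refine H.apply_ne ?_
      rw [← add_mul]
      refine mul_ne_zero ?_ H.pos.ne'
      have : n + m ≠ 0 := by omega
      exact_mod_cast this
    rw [H.coord_eq x n (h ▸ h1), H.coord_eq x' n (h' ▸ h1), h, h']

theorem ne_of_mem_Ioo {m : ℤ} {t : ℝ} (h : t ∈ Ioo (m * τ) ((m + 1) * τ)) (n : ℤ) :
    φ t y₀ ≠ φ (n * τ) y₀ := by
  intro h1
  have h2 := H.eq_of_apply_eq h1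
  rw [h2] at h
  have h3 : (m : ℝ) < n := lt_of_mul_lt_mul_right h.1 H.pos.le
  have h4 : (n : ℝ) < m + 1 := lt_of_mul_lt_mul_right h.2 H.pos.le
  have h5 : m < n := by exact_mod_cast h3
  have h6 : n < m + 1 := by exact_mod_cast h4
  omega

/-- Approach time `mτ` from the right along times at which the coordinate `-m` equals `s` exactly;
the other coordinates converge by continuity. -/
theorem on_orbit_mem [T2Space Y] (m : ℤ) (s : unitInterval) :
    (φ (m * τ) y₀, fun n : ℤ => if n = -m then s else v (φ ((n + m) * τ) y₀)) ∈
      closure (itineraryGraph φ τ y₀ v) := by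
  have h1 : ∀ k : ℕ, ∃ t ∈ Ioo (0 : ℝ) (min τ (1 / ((k : ℝ) + 1))), v (φ t y₀) = s := fun k =>
    H.osc s _ (lt_min H.pos Nat.one_div_pos_of_nat)
  choose t ht hv using h1
  have ht0 : Filter.Tendsto t Filter.atTop (𝓝 0) :=
    squeeze_zero (fun k => (ht k).1.le) (fun k => (ht k).2.le.trans (min_le_right _ _))
      tendsto_one_div_add_atTop_nhds_zero_nat
  refine mem_closure_of_tendsto (b := Filter.atTop) (f := fun k =>
    (φ (m * τ + t k) y₀, fun n : ℤ => v (φ (n * τ) (φ (m * τ + t k) y₀)))) ?_ ?_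
  · have h2 : Filter.Tendsto (fun k => φ (m * τ + t k) y₀) Filter.atTop (𝓝 (φ (m * τ) y₀)) := by
      have : Continuous fun r : ℝ => φ (m * τ + r) y₀ := by fun_prop
      have h3 := (this.tendsto 0).comp ht0
      simpa [Function.comp_def] using h3
    refine h2.prodMk_nhds (tendsto_pi_nhds.2 fun n => ?_)
    by_cases hn : n = -m
    · simp only [hn, if_true]
      refine tendsto_const_nhds.congr fun k => ?_
      rw [← Flow.map_add, ← hv k]
      congr 2
      push_cast
      ring
    · simp only [hn, if_false]
      have h4 : φ ((n + m) * τ) y₀ ≠ y₀ := by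
        refine H.apply_ne (mul_ne_zero ?_ H.pos.ne')
        have : n + m ≠ 0 := by omega
        exact_mod_cast this
      have h5 := H.cont.continuousAt (isOpen_compl_singleton.mem_nhds h4)
      refine h5.tendsto.comp ?_
      have : Continuous fun r : ℝ => φ (n * τ) (φ (m * τ + r) y₀) := by fun_prop
      have h3 := (this.tendsto 0).comp ht0
      simpa [Function.comp_def, ← Flow.map_add, add_mul] using h3
  · refine Filter.Eventually.of_forall fun k => ⟨fun n => ?_, fun n => rfl⟩
    refine H.ne_of_mem_Ioo (m := m) ⟨by linarith [(ht k).1], ?_⟩ n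
    have := (ht k).2.trans_le (min_le_left _ _)
    linarith

/-- The point over `m τ` in the flow line of `y₀` with free coordinate `s`. -/
def orbitPoint [T2Space Y] (m : ℤ) (s : unitInterval) : ItinerarySpace φ τ y₀ v :=
  ⟨_, H.on_orbit_mem m s⟩

theorem continuous_orbitPoint [T2Space Y] (m : ℤ) : Continuous (H.orbitPoint m) := by
  refine Continuous.subtype_mk (continuous_const.prodMk (continuous_pi fun n => ?_)) _
  by_cases hn : n = -m
  · simpa [hn] using continuous_id'
  · simpa [hn] using continuous_const

theorem eq_orbitPoint [T2Space Y] {x : ItinerarySpace φ τ y₀ v} {m : ℤ}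
    (h : x.1.1 = φ (m * τ) y₀) : x = H.orbitPoint m (x.1.2 (-m)) :=
  H.ext_on_orbit h rfl (by simp [orbitPoint])

theorem exists_over [T2Space Y] (y : Y) : ∃ x : ItinerarySpace φ τ y₀ v, x.1.1 = y := by
  by_cases h : ∀ n : ℤ, y ≠ φ (n * τ) y₀
  · exact ⟨⟨_, mk_mem_closure_itineraryGraph h⟩, rfl⟩
  · push Not at h
    obtain ⟨n, rfl⟩ := h
    exact ⟨H.orbitPoint n 0, rfl⟩

/-! ### Path components of the itinerary space. -/

theorem joined_off_line [T2Space Y] {x x' : ItinerarySpace φ τ y₀ v} {t : ℝ}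
    (hx : ∀ s, x.1.1 ≠ φ s y₀) (hx' : x'.1.1 = φ t x.1.1) : Joined x x' := by
  have h1 : ∀ s r, φ s x.1.1 ≠ φ r y₀ := by
    intro s r h
    rw [Flow.apply_eq_iff_neg, ← Flow.map_add] at h
    exact hx _ h
  let F : ℝ → ItinerarySpace φ τ y₀ v := fun s => ⟨_, mk_mem_closure_itineraryGraph (fun n => h1 s (n * τ))⟩
  have hF : Continuous F := by
    refine Continuous.subtype_mk (Continuous.prodMk (by fun_prop) (continuous_pi fun n => ?_)) _
    refine H.cont.comp_continuous (by fun_prop) fun s => ?_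
    rw [← Flow.map_add]
    simpa using h1 (n * τ + s) 0
  have hx0 : x = F 0 := H.ext_off_orbit (by simp [F]) (fun n => hx _)
  have hx1 : x' = F t := H.ext_off_orbit (by simpa [F] using hx') (fun n => by
    rw [hx']
    exact h1 _ _)
  rw [hx0, hx1]
  exact (PathConnectedSpace.joined 0 t).map hF

/-- The value `0` at time `0` is the left limit of `v` along the flow line, and an interval closed
on the right sees only this limit. -/
theorem continuousOn_halfOpen [T2Space Y] (j : ℤ) :
    ContinuousOn (fun t : ℝ => if t = 0 then 0 else v (φ t y₀))
      (Ioc (j * τ) ((j + 1) * τ)) := by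
  intro t ht
  by_cases h0 : t = 0
  · subst h0
    have h1 : (j : ℝ) < 0 := by
      by_contra! h
      exact absurd ht.1 (not_lt.2 (mul_nonneg h H.pos.le))
    have h2 : (0 : ℝ) ≤ j + 1 := by
      by_contra! h
      exact absurd ht.2 (not_le.2 (mul_neg_of_neg_of_pos h H.pos))
    have h3 : j = -1 := by
      have h1' : j < 0 := by exact_mod_cast h1
      have h2' : 0 ≤ j + 1 := by exact_mod_cast h2
      omega
    subst h3
    have h4 : ContinuousWithinAt (fun _ : ℝ => (0 : unitInterval))
      (Ioc (((-1 : ℤ) : ℝ) * τ) ((((-1 : ℤ) : ℝ) + 1) * τ)) 0 := continuousWithinAt_const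
    refine h4.congr_of_eventuallyEq ?_ (by simp)
    have h5 : Ioo (-(1 / 2) : ℝ) 1 ∈ 𝓝 (0 : ℝ) := Ioo_mem_nhds (by norm_num) (by norm_num)
    filter_upwards [nhdsWithin_le_nhds h5, self_mem_nhdsWithin] with s hs hs'
    split_ifs with hs0
    · rfl
    · refine H.neg s ⟨hs.1.le, lt_of_le_of_ne ?_ hs0⟩
      simpa using hs'.2
  · refine ContinuousAt.continuousWithinAt ?_
    have h1 : ContinuousAt (fun t : ℝ => v (φ t y₀)) t :=
      ContinuousAt.comp (f := fun t : ℝ => φ t y₀) (g := v)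
        (H.cont.continuousAt (isOpen_compl_singleton.mem_nhds (H.apply_ne h0))) (by fun_prop)
    refine h1.congr ?_
    filter_upwards [isOpen_ne.mem_nhds h0] with s hs
    exact (if_neg hs).symm

theorem halfOpen_mem [T2Space Y] (t : ℝ) :
    (φ t y₀, fun n : ℤ => if t + n * τ = 0 then (0 : unitInterval) else v (φ (t + n * τ) y₀)) ∈
      closure (itineraryGraph φ τ y₀ v) := by
  by_cases h : ∃ m : ℤ, t = m * τ
  · obtain ⟨m, rfl⟩ := h
    convert H.on_orbit_mem m 0 using 4 with n
    · rw [← add_mul, mul_eq_zero, or_iff_left H.pos.ne']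
      constructor
      · intro h
        have : m + n = 0 := by exact_mod_cast h
        omega
      · rintro rfl
        simp
    · rw [← add_mul, add_comm]
  · push Not at h
    have h1 := mk_mem_closure_itineraryGraph (v := v) (y := φ t y₀) fun n hn => h n (H.eq_of_apply_eq hn)
    convert h1 using 3 with n
    rw [if_neg, ← Flow.map_add, add_comm]
    intro h2
    exact h (-n) (by push_cast; linarith)

/-- The section with free coordinate `0` is continuous over the half-open interval, and the fibre
over the right end point is itself an interval. -/
theorem joined_on_line [T2Space Y] {x x' : ItinerarySpace φ τ y₀ v} {t t' : ℝ} {m : ℤ}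
    (hx : x.1.1 = φ t y₀) (hx' : x'.1.1 = φ t' y₀) (ht : t ∈ Ioc (m * τ) ((m + 1) * τ))
    (ht' : t' ∈ Ioc (m * τ) ((m + 1) * τ)) : Joined x x' := by
  let F : ℝ → ItinerarySpace φ τ y₀ v := fun s => ⟨_, H.halfOpen_mem s⟩
  have hF : ContinuousOn F (Ioc (m * τ) ((m + 1) * τ)) := by
    rw [IsEmbedding.subtypeVal.continuousOn_iff]
    refine ContinuousOn.prodMk (by fun_prop) (continuousOn_pi.2 fun n => ?_)
    refine (H.continuousOn_halfOpen (m + n)).comp (f := fun t : ℝ => t + n * τ) (by fun_prop) ?_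
    intro s hs
    push_cast
    constructor <;> linarith [hs.1, hs.2]
  have key : ∀ (x : ItinerarySpace φ τ y₀ v) (t : ℝ), x.1.1 = φ t y₀ →
      t ∈ Ioc (m * τ) ((m + 1) * τ) → Joined x (F t) := by
    intro x t hx ht
    rcases ht.2.lt_or_eq with h | rfl
    · have := H.ext_off_orbit (x := x) (x' := F t) hx fun n => by
        rw [hx]
        exact H.ne_of_mem_Ioo ⟨ht.1, h⟩ n
      rw [this]
    · have e : ((m : ℝ) + 1) * τ = ((m + 1 : ℤ) : ℝ) * τ := by push_cast; rfl
      rw [e] at hx ⊢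
      rw [H.eq_orbitPoint hx, H.eq_orbitPoint (x := F (((m + 1 : ℤ) : ℝ) * τ)) rfl]
      have : PathConnectedSpace unitInterval := isPathConnected_iff_pathConnectedSpace.1
        ((convex_Icc (0 : ℝ) 1).isPathConnected ⟨0, by simp⟩)
      exact (PathConnectedSpace.joined _ _).map (H.continuous_orbitPoint _)
  refine (key x t hx ht).trans (Joined.trans ?_ (key x' t' hx' ht').symm)
  have h1 : IsPathConnected (Ioc (m * τ) ((m + 1) * τ)) :=
    (convex_Ioc _ _).isPathConnected ⟨t, ht⟩
  have h2 := h1.image' hF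
  exact (h2.joinedIn _ (mem_image_of_mem F ht) _ (mem_image_of_mem F ht')).joined

/-- After the last time with `Θ ≤ jτ`, the coordinate `-j` reads `v` just after `y₀`. By the
intermediate value theorem it takes all values in `[0,1]` within an arbitrarily short time, against
continuity. -/
theorem not_crossing [T2Space Y] {Γ : ℝ → ItinerarySpace φ τ y₀ v} (hΓ : Continuous Γ)
    {Θ : ℝ → ℝ} (hΘ : Continuous Θ) (hΓΘ : ∀ t, (Γ t).1.1 = φ (Θ t) y₀) (j : ℤ) {a b : ℝ}
    (hab : a ≤ b) (ha : Θ a ≤ j * τ) (hb : j * τ < Θ b) : False := by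
  obtain ⟨t₁, ⟨⟨ht₁a, ht₁b⟩, ht₁⟩, hmax⟩ := ((isCompact_Icc (a := a) (b := b)).inter_right
    (isClosed_le hΘ continuous_const)).exists_isGreatest ⟨a, left_mem_Icc.2 hab, ha⟩
  have ht₁b' : t₁ < b := by
    refine lt_of_le_of_ne ht₁b ?_
    rintro rfl
    exact absurd ht₁ (not_le.2 hb)
  have hgt : ∀ t, t₁ < t → t ≤ b → j * τ < Θ t := by
    intro t h1 h2
    by_contra! h3
    exact absurd (hmax ⟨⟨ht₁a.trans h1.le, h2⟩, h3⟩) (not_le.2 h1)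
  have hS : Continuous fun t => (((Γ t).1.2 (-j) : unitInterval) : ℝ) := by fun_prop
  have hv : ∀ t, j * τ < Θ t → (Γ t).1.2 (-j) = v (φ (Θ t - j * τ) y₀) := by
    intro t ht
    have e : φ (((-j : ℤ) : ℝ) * τ) (Γ t).1.1 = φ (Θ t - j * τ) y₀ := by
      rw [hΓΘ, ← Flow.map_add]
      congr 1
      push_cast
      ring
    rw [H.coord_eq (Γ t) (-j), e]
    rw [e]
    exact H.apply_ne (by linarith)
  have hnear := (Metric.tendsto_nhds.1 (hS.tendsto t₁)) (1 / 2) (by norm_num)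
  obtain ⟨ε, hε, hball⟩ := Metric.eventually_nhds_iff.1 hnear
  set t₂ := min b (t₁ + ε / 2)
  have h12 : t₁ < t₂ := lt_min ht₁b' (by linarith)
  have h2b : t₂ ≤ b := min_le_left _ _
  have hclose : ∀ t ∈ Icc t₁ t₂, |((Γ t).1.2 (-j) : ℝ) - (Γ t₁).1.2 (-j)| < 1 / 2 := by
    intro t ht
    refine hball ?_
    rw [Real.dist_eq, abs_lt]
    have := ht.2.trans (min_le_right b (t₁ + ε / 2))
    constructor <;> linarith [ht.1]
  have hall : ∀ s : unitInterval, ∃ t ∈ Icc t₁ t₂, (Γ t).1.2 (-j) = s := by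
    intro s
    obtain ⟨r, hr, hrs⟩ := H.osc s (Θ t₂ - j * τ) (sub_pos.2 (hgt t₂ h12 h2b))
    obtain ⟨t, ht, htr⟩ := intermediate_value_Icc h12.le hΘ.continuousOn
      (show j * τ + r ∈ Icc (Θ t₁) (Θ t₂) from
        ⟨ht₁.trans (by linarith [hr.1]), by linarith [hr.2]⟩)
    refine ⟨t, ht, ?_⟩
    rw [hv t (by linarith [hr.1]), htr, add_sub_cancel_left, hrs]
  obtain ⟨t, ht, ht0⟩ := hall 0
  obtain ⟨t', ht', ht1⟩ := hall 1
  have h0 := hclose t ht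
  have h1 := hclose t' ht'
  rw [ht0, abs_lt] at h0
  rw [ht1, abs_lt] at h1
  simp only [Set.Icc.coe_zero, Set.Icc.coe_one] at h0 h1
  linarith [h0.1, h0.2, h1.1, h1.2]

/-- The set of points over `φ t y₀`, `t ∈ (m τ, (m + 1) τ]`, is a path component. -/
theorem mem_of_joined [T2Space Y] {x x' : ItinerarySpace φ τ y₀ v} {t : ℝ} {m : ℤ}
    (hx : x.1.1 = φ t y₀) (ht : t ∈ Ioc (m * τ) ((m + 1) * τ)) (h : Joined x x') :
    ∃ t' ∈ Ioc (m * τ) ((m + 1) * τ), x'.1.1 = φ t' y₀ := by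
  obtain ⟨γ⟩ := h
  obtain ⟨θ, hθ0, hθ⟩ := H.lift ⟨fun s => (γ s).1.1, by fun_prop⟩
  have hθ' : ∀ s, (γ s).1.1 = φ (θ s + t) y₀ := by
    intro s
    have h1 := hθ s
    simp only [ContinuousMap.coe_mk, γ.source] at h1
    rw [h1, hx, ← Flow.map_add]
  let p : ℝ → unitInterval := projIcc 0 1 zero_le_one
  have hp : Continuous p := continuous_projIcc
  have hp0 : p 0 = 0 := projIcc_left zero_le_one
  have hp1 : p 1 = 1 := projIcc_right zero_le_one
  have hΓ : Continuous fun s => γ (p s) := by fun_prop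
  have hΘ : Continuous fun s => θ (p s) + t := by fun_prop
  refine ⟨θ 1 + t, ⟨?_, ?_⟩, by rw [← hθ', γ.target]⟩
  · by_contra! h
    -- Leaving through the lower end is a crossing for the reversed path.
    refine H.not_crossing (Γ := fun s => γ (p (-s))) (hΓ.comp continuous_neg)
      (Θ := fun s => θ (p (-s)) + t) (hΘ.comp continuous_neg) (fun s => hθ' _) m
      (a := -1) (b := 0) (by norm_num) ?_ ?_
    · simpa [hp1] using h
    · simpa [hp0, hθ0] using ht.1
  · by_contra! h
    refine H.not_crossing (Γ := fun s => γ (p s)) hΓ hΘ (fun s => hθ' _) (m + 1)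
      (a := 0) (b := 1) zero_le_one ?_ ?_
    · simpa [hp0, hθ0] using ht.2
    · simpa [hp1] using h

end OscillatingFlow

/-- The shift of the itinerary space, which lifts the time `τ` map. -/
def itineraryShift (φ : Flow ℝ Y) (τ : ℝ) (y₀ : Y) (v : Y → unitInterval) :
    ItinerarySpace φ τ y₀ v ≃ₜ ItinerarySpace φ τ y₀ v := by
  let e : Y × (ℤ → unitInterval) ≃ₜ Y × (ℤ → unitInterval) :=
    { toFun := fun p => (φ τ p.1, fun n => p.2 (n + 1))
      invFun := fun p => (φ (-τ) p.1, fun n => p.2 (n - 1))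
      left_inv := fun p => by simp [← Flow.map_add]
      right_inv := fun p => by simp [← Flow.map_add]
      continuous_toFun := by fun_prop
      continuous_invFun := by fun_prop }
  refine e.sets ?_
  rw [e.preimage_closure]
  congr 1
  ext p
  simp only [itineraryGraph, mem_preimage, mem_ofPred_eq]
  have he : e p = (φ τ p.1, fun n => p.2 (n + 1)) := rfl
  rw [he]
  refine and_congr ?_ ?_
  · simp only [ne_eq, Flow.apply_eq_iff_neg, ← Flow.map_add]
    constructor
    · intro h n
      convert h (n - 1) using 3
      push_cast
      ring
    · intro h n
      convert h (n + 1) using 3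
      push_cast
      ring
  · simp only [← Flow.map_add]
    constructor
    · intro h n
      rw [h]
      congr 2
      push_cast
      ring
    · intro h n
      convert h (n - 1) using 3
      · ring
      · push_cast
        ring

theorem itineraryShift_fst (x : ItinerarySpace φ τ y₀ v) :
    (itineraryShift φ τ y₀ v x).1.1 = φ τ x.1.1 := rfl

theorem isClosedMap_itinerary_fst [CompactSpace Y] [T2Space Y] :
    IsClosedMap fun x : ItinerarySpace φ τ y₀ v => x.1.1 := by
  have : CompactSpace (ItinerarySpace φ τ y₀ v) :=
    isCompact_iff_compactSpace.1 isClosed_closure.isCompact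
  exact Continuous.isClosedMap (by fun_prop)

end Itinerary


/-! ### Collapsing invariant sets of the itinerary space -/

/-- The quotient of a compact Hausdorff space by a closed map is Hausdorff. -/
theorem t2Space_of_isClosedMap_surjective {X R : Type*} [TopologicalSpace X] [CompactSpace X]
    [T2Space X] [TopologicalSpace R] {Q : X → R} (hc : Continuous Q) (hs : Function.Surjective Q)
    (hQ : IsClosedMap Q) : T2Space R := by
  refine ⟨fun r r' hr => ?_⟩
  have hcl : ∀ r, IsClosed (Q ⁻¹' {r}) := by
    intro r
    obtain ⟨x, rfl⟩ := hs r
    have h1 := hQ {x} isClosed_singleton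
    rw [image_singleton] at h1
    exact h1.preimage hc
  obtain ⟨U, V, hU, hV, hrU, hrV, hUV⟩ := normal_separation (hcl r) (hcl r')
    (Disjoint.preimage Q (disjoint_singleton.2 hr))
  refine ⟨kernImage Q U, kernImage Q V, isClosedMap_iff_kernImage.1 hQ hU,
    isClosedMap_iff_kernImage.1 hQ hV, fun x hx => hrU hx, fun x hx => hrV hx, ?_⟩
  rw [Set.disjoint_left]
  intro s hs1 hs2
  obtain ⟨x, rfl⟩ := hs s
  exact Set.disjoint_left.1 hUV (hs1 rfl) (hs2 rfl)

theorem Homeomorph.image_pathComponent_eq {X X' : Type*} [TopologicalSpace X]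
    [TopologicalSpace X'] (k : X ≃ₜ X') (x : X) :
    k '' pathComponent x = pathComponent (k x) := by
  ext y
  constructor
  · rintro ⟨z, hz, rfl⟩
    exact Joined.map hz k.continuous
  · intro hy
    refine ⟨k.symm y, ?_, k.apply_symm_apply y⟩
    have h := Joined.map hy k.symm.continuous
    rwa [k.symm_apply_apply] at h

section Collapse

variable {Y : Type*} [TopologicalSpace Y] {A R : Type*} [TopologicalSpace R]
  {φ : Flow ℝ Y} {τ : ℝ} {y₀ : Y} {v : Y → unitInterval}

/-- A quotient map of the itinerary space which identifies two points exactly when they are equal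
or when they have the same value under a flow-invariant partial map `ρ` on the base which is
undefined at `y₀`. -/
structure IsCollapse (ρ : Y → Option A) (Q : ItinerarySpace φ τ y₀ v → R) : Prop where
  quot : IsQuotientMap Q
  eq_iff : ∀ x x', Q x = Q x' ↔ x = x' ∨ ∃ c, ρ x.1.1 = some c ∧ ρ x'.1.1 = some c
  flow : ∀ t y, ρ (φ t y) = ρ y
  base : ρ y₀ = none
  closed : IsClosed {q : Y × Y | ∃ c, ρ q.1 = some c ∧ ρ q.2 = some c}

/-- The points of the itinerary space over `φ t y₀`, `t ∈ (m τ, (m + 1) τ]`. -/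
def strand (φ : Flow ℝ Y) (τ : ℝ) (y₀ : Y) (v : Y → unitInterval) (m : ℤ) :
    Set (ItinerarySpace φ τ y₀ v) :=
  {x | ∃ t ∈ Ioc (m * τ) ((m + 1) * τ), x.1.1 = φ t y₀}

theorem OscillatingFlow.exists_mem_strand (H : OscillatingFlow φ τ y₀ v)
    {x : ItinerarySpace φ τ y₀ v} {s : ℝ} (h : x.1.1 = φ s y₀) : ∃ m, x ∈ strand φ τ y₀ v m := by
  have hτ := H.pos
  refine ⟨⌈s / τ⌉ - 1, s, ⟨?_, ?_⟩, h⟩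
  · have := Int.ceil_lt_add_one (s / τ)
    push_cast
    rw [← lt_div_iff₀ hτ]
    linarith
  · have := Int.le_ceil (s / τ)
    push_cast
    rw [← div_le_iff₀ hτ]
    linarith

theorem OscillatingFlow.mem_strand_of_joined [T2Space Y] (H : OscillatingFlow φ τ y₀ v)
    {x x' : ItinerarySpace φ τ y₀ v} {m : ℤ} (hx : x ∈ strand φ τ y₀ v m) (h : Joined x x') :
    x' ∈ strand φ τ y₀ v m := by
  obtain ⟨t, ht, hxt⟩ := hx
  exact H.mem_of_joined hxt ht h

theorem OscillatingFlow.joined_of_mem_strand [T2Space Y] (H : OscillatingFlow φ τ y₀ v)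
    {x x' : ItinerarySpace φ τ y₀ v} {m : ℤ} (hx : x ∈ strand φ τ y₀ v m)
    (hx' : x' ∈ strand φ τ y₀ v m) : Joined x x' := by
  obtain ⟨t, ht, hxt⟩ := hx
  obtain ⟨t', ht', hxt'⟩ := hx'
  exact H.joined_on_line hxt hxt' ht ht'

theorem OscillatingFlow.strand_nonempty [T2Space Y] (H : OscillatingFlow φ τ y₀ v) (m : ℤ) :
    (strand φ τ y₀ v m).Nonempty := by
  obtain ⟨x, hx⟩ := H.exists_over (φ ((m + 1) * τ) y₀)
  exact ⟨x, _, ⟨by linarith [H.pos], le_rfl⟩, hx⟩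

/-- Near a point off the orbit of `y₀` there are full fibres over points of this orbit. -/
theorem OscillatingFlow.exists_fibre_subset [CompactSpace Y] [T2Space Y]
    (H : OscillatingFlow φ τ y₀ v) {x : ItinerarySpace φ τ y₀ v}
    (hx : ∀ n : ℤ, x.1.1 ≠ φ (n * τ) y₀) {G : Set (ItinerarySpace φ τ y₀ v)} (hG : IsOpen G)
    (hxG : x ∈ G) {D : Set Y} (hD : Dense D) :
    ∃ y ∈ D, ∀ x' : ItinerarySpace φ τ y₀ v, x'.1.1 = y → x' ∈ G := by
  -- The fibre through `x` is a single point and the projection is closed, so all nearby fibres lie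
  -- in `G`.
  have h1 := isClosedMap_iff_kernImage.1
    (isClosedMap_itinerary_fst (φ := φ) (τ := τ) (y₀ := y₀) (v := v)) hG
  obtain ⟨y, hy, hyD⟩ := hD.inter_open_nonempty _ h1
    ⟨x.1.1, fun x' hx' => H.ext_off_orbit hx'.symm hx ▸ hxG⟩
  exact ⟨y, hyD, fun x' hx' => hy hx'⟩

theorem OscillatingFlow.exists_orbit_fibre_subset [CompactSpace Y] [T2Space Y]
    (H : OscillatingFlow φ τ y₀ v) {G : Set (ItinerarySpace φ τ y₀ v)} (hG : IsOpen G)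
    (hne : G.Nonempty) {D : Set Y} (hD : Dense D) :
    ∃ y ∈ D, ∀ x' : ItinerarySpace φ τ y₀ v, x'.1.1 = y → x' ∈ G := by
  obtain ⟨x, hxG, hx⟩ := dense_itinerary_off_orbit.inter_open_nonempty G hG hne
  exact H.exists_fibre_subset hx hG hxG hD

theorem zpow_apply_of_lifts_shift {Q : ItinerarySpace φ τ y₀ v → R} {hR : R ≃ₜ R}
    (hhR : ∀ x, hR (Q x) = Q (itineraryShift φ τ y₀ v x)) (n : ℤ) (x : ItinerarySpace φ τ y₀ v) :
    ∃ x' : ItinerarySpace φ τ y₀ v, (hR ^ n : R ≃ₜ R) (Q x) = Q x' ∧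
      x'.1.1 = φ (n * τ) x.1.1 := by
  have hinv : ∀ x, (hR⁻¹ : R ≃ₜ R) (Q x) = Q ((itineraryShift φ τ y₀ v).symm x) := by
    intro x
    have := hhR ((itineraryShift φ τ y₀ v).symm x)
    rw [Homeomorph.apply_symm_apply] at this
    exact hR.symm_apply_eq.2 this.symm
  have hsymm : ∀ x, ((itineraryShift φ τ y₀ v).symm x).1.1 = φ (-τ) x.1.1 := fun x => rfl
  induction n generalizing x with
  | zero => exact ⟨x, by simp, by simp⟩
  | succ n ih =>
    obtain ⟨x', h1, h2⟩ := ih (itineraryShift φ τ y₀ v x)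
    refine ⟨x', ?_, ?_⟩
    · rw [zpow_add_one, ← h1, ← hhR]
      rfl
    · rw [h2, itineraryShift_fst, ← Flow.map_add]
      congr 1
      push_cast
      ring
  | pred n ih =>
    obtain ⟨x', h1, h2⟩ := ih ((itineraryShift φ τ y₀ v).symm x)
    refine ⟨x', ?_, ?_⟩
    · rw [zpow_sub_one, ← h1, ← hinv]
      rfl
    · rw [h2, hsymm, ← Flow.map_add]
      congr 1
      push_cast
      ring

namespace IsCollapse

variable {ρ : Y → Option A} {Q : ItinerarySpace φ τ y₀ v → R} (C : IsCollapse ρ Q)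
include C

theorem isOpen_none : IsOpen {y | ρ y = none} := by
  have h1 : IsClosed {y | ∃ c, ρ y = some c ∧ ρ y = some c} :=
    C.closed.preimage (continuous_id.prodMk continuous_id)
  convert h1.isOpen_compl using 1
  ext y
  simp [← Option.isSome_iff_exists]

theorem eq_of_none {x x' : ItinerarySpace φ τ y₀ v} (hx : ρ x.1.1 = none) (h : Q x = Q x') :
    x = x' := by
  rcases (C.eq_iff x x').1 h with h | ⟨c, h, -⟩
  · exact h
  · rw [hx] at h
    cases h

theorem none_of_line {x : ItinerarySpace φ τ y₀ v} {t : ℝ} (h : x.1.1 = φ t y₀) :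
    ρ x.1.1 = none := by rw [h, C.flow, C.base]

theorem none_of_mem_strand {x : ItinerarySpace φ τ y₀ v} {m : ℤ} (h : x ∈ strand φ τ y₀ v m) :
    ρ x.1.1 = none := by
  obtain ⟨t, -, h⟩ := h
  exact C.none_of_line h

theorem mem_of_mem_image {V : Set (ItinerarySpace φ τ y₀ v)} {x : ItinerarySpace φ τ y₀ v}
    (hx : ρ x.1.1 = none) (h : Q x ∈ Q '' V) : x ∈ V := by
  obtain ⟨x', hx', h'⟩ := h
  rwa [C.eq_of_none hx h'.symm]

theorem isOpen_image {V : Set (ItinerarySpace φ τ y₀ v)} (hV : IsOpen V)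
    (h : ∀ x ∈ V, ρ x.1.1 = none) : IsOpen (Q '' V) := by
  rw [← C.quot.isOpen_preimage]
  convert hV using 1
  ext x
  constructor
  · rintro ⟨x', hx', h'⟩
    rwa [← C.eq_of_none (h x' hx') h']
  · exact fun hx => mem_image_of_mem Q hx

theorem isOpen_free : IsOpen (Q '' {x | ρ x.1.1 = none}) :=
  C.isOpen_image (C.isOpen_none.preimage (by fun_prop)) fun _ hx => hx

theorem surjInv_apply {x : ItinerarySpace φ τ y₀ v} (hx : ρ x.1.1 = none) :
    Function.surjInv C.quot.surjective (Q x) = x :=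
  (C.eq_of_none hx (Function.surjInv_eq C.quot.surjective (Q x)).symm).symm

/-- `Q` is injective and open over the set where `ρ` is undefined, so paths can be lifted there. -/
theorem continuousOn_surjInv :
    ContinuousOn (Function.surjInv C.quot.surjective) (Q '' {x | ρ x.1.1 = none}) := by
  rintro _ ⟨x, hx, rfl⟩
  refine ContinuousAt.continuousWithinAt ?_
  rw [ContinuousAt, C.surjInv_apply hx, tendsto_nhds]
  intro O hO hxO
  have h1 : IsOpen (Q '' (O ∩ {x | ρ x.1.1 = none})) :=
    C.isOpen_image (hO.inter (C.isOpen_none.preimage (by fun_prop))) fun _ hx => hx.2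
  filter_upwards [h1.mem_nhds (mem_image_of_mem Q ⟨hxO, hx⟩)]
  rintro _ ⟨z, ⟨hzO, hz⟩, rfl⟩
  rw [mem_preimage, C.surjInv_apply hz]
  exact hzO

variable [CompactSpace Y] [T2Space Y]

theorem isClosedMap : IsClosedMap Q := by
  have : CompactSpace (ItinerarySpace φ τ y₀ v) :=
    isCompact_iff_compactSpace.1 isClosed_closure.isCompact
  intro F hF
  rw [← C.quot.isClosed_preimage]
  have h1 : IsClosed ({q : ItinerarySpace φ τ y₀ v × ItinerarySpace φ τ y₀ v | q.1 = q.2} ∪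
      {q | ∃ c, ρ q.1.1.1 = some c ∧ ρ q.2.1.1 = some c}) := by
    refine (isClosed_eq continuous_fst continuous_snd).union ?_
    exact C.closed.preimage (f := fun q : ItinerarySpace φ τ y₀ v × ItinerarySpace φ τ y₀ v =>
      (q.1.1.1, q.2.1.1)) (by fun_prop)
  convert isClosedMap_snd_of_compactSpace _ (h1.inter (hF.preimage continuous_fst)) using 1
  ext x
  constructor
  · rintro ⟨z, hz, h⟩
    exact ⟨(z, x), ⟨(C.eq_iff z x).1 h, hz⟩, rfl⟩
  · rintro ⟨⟨z, x⟩, ⟨h, hz⟩, rfl⟩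
    exact ⟨z, hz, (C.eq_iff z x).2 h⟩

theorem t2Space : T2Space R := by
  have : CompactSpace (ItinerarySpace φ τ y₀ v) :=
    isCompact_iff_compactSpace.1 isClosed_closure.isCompact
  exact t2Space_of_isClosedMap_surjective C.quot.continuous C.quot.surjective C.isClosedMap

theorem closure_strand_subset (m : ℤ) : closure (Q '' strand φ τ y₀ v m) ⊆
    Q '' {x | x ∈ strand φ τ y₀ v m ∨ x.1.1 = φ (m * τ) y₀} := by
  have h1 : IsClosed ((fun t => φ t y₀) '' Icc (m * τ) ((m + 1) * τ)) :=
    (isCompact_Icc.image (by fun_prop)).isClosed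
  have h2 : IsClosed {x : ItinerarySpace φ τ y₀ v |
      x.1.1 ∈ (fun t => φ t y₀) '' Icc (m * τ) ((m + 1) * τ)} := h1.preimage (by fun_prop)
  refine (closure_minimal (image_mono ?_) (C.isClosedMap _ h2)).trans (image_mono ?_)
  · rintro x ⟨t, ht, hx⟩
    exact ⟨t, Ioc_subset_Icc_self ht, hx.symm⟩
  · rintro x ⟨t, ht, hx⟩
    rcases ht.1.lt_or_eq with h | rfl
    · exact Or.inl ⟨t, ⟨h, ht.2⟩, hx.symm⟩
    · exact Or.inr hx.symm

/-! ### Strands as path components of the collapsed space. -/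

variable (H : OscillatingFlow φ τ y₀ v)
include H

/-- Inside the open set where `Q` is invertible, a path locally lifts and stays in one path
component upstairs. The closure of a strand lies in this open set, so the times spent in the strand
form a clopen subset of `[0,1]`. -/
theorem mem_strand_of_joined {r r' : R} {m : ℤ} (hr : r ∈ Q '' strand φ τ y₀ v m)
    (h : Joined r r') : r' ∈ Q '' strand φ τ y₀ v m := by
  obtain ⟨γ⟩ := h
  have : LocallyPathConnectedSpace unitInterval := (convex_Icc (0 : ℝ) 1).locallyPathConnectedSpace
  have key : ∀ t, γ t ∈ Q '' {x | ρ x.1.1 = none} → ∃ N ∈ 𝓝 t, ∀ t₁ ∈ N, ∀ t₂ ∈ N,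
      γ t₁ ∈ Q '' strand φ τ y₀ v m → γ t₂ ∈ Q '' strand φ τ y₀ v m := by
    intro t ht
    obtain ⟨N, ⟨hN, hNp, hNs⟩, -⟩ := (pathConnected_subset_basis
      (C.isOpen_free.preimage γ.continuous) ht).mem_iff.1 Filter.univ_mem
    refine ⟨N, hN, fun t₁ ht₁ t₂ ht₂ h1 => ?_⟩
    have h2 := (hNp.image γ.continuous).image' (C.continuousOn_surjInv.mono (by
      rintro _ ⟨s, hs, rfl⟩
      exact hNs hs))
    have h3 := (h2.joinedIn _ (mem_image_of_mem _ (mem_image_of_mem γ ht₁)) _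
      (mem_image_of_mem _ (mem_image_of_mem γ ht₂))).joined
    obtain ⟨x₁, hx₁, hx₁'⟩ := h1
    obtain ⟨x₂, hx₂, hx₂'⟩ := hNs ht₂
    rw [← hx₁', ← hx₂', C.surjInv_apply (C.none_of_mem_strand hx₁), C.surjInv_apply hx₂] at h3
    exact ⟨x₂, H.mem_strand_of_joined hx₁ h3, hx₂'⟩
  have hfree : closure (Q '' strand φ τ y₀ v m) ⊆ Q '' {x | ρ x.1.1 = none} := by
    refine (C.closure_strand_subset m).trans (image_mono ?_)
    rintro x (hx | hx)
    · exact C.none_of_mem_strand hx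
    · exact C.none_of_line hx
  have hS : IsClopen (γ ⁻¹' (Q '' strand φ τ y₀ v m)) := by
    constructor
    · refine isClosed_of_closure_subset fun t ht => ?_
      have h1 : γ t ∈ closure (Q '' strand φ τ y₀ v m) :=
        closure_mono (image_preimage_subset _ _) (image_closure_subset_closure_image γ.continuous
          (mem_image_of_mem γ ht))
      obtain ⟨N, hN, h⟩ := key t (hfree h1)
      obtain ⟨t₁, ht₁, ht₁'⟩ := mem_closure_iff_nhds.1 ht N hN
      exact h t₁ ht₁ t (mem_of_mem_nhds hN) ht₁'
    · rw [isOpen_iff_mem_nhds]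
      intro t ht
      obtain ⟨N, hN, h⟩ := key t (hfree (subset_closure ht))
      exact Filter.mem_of_superset hN fun t₂ ht₂ => h t (mem_of_mem_nhds hN) t₂ ht₂ ht
  have hu := hS.eq_univ ⟨0, by simpa using hr⟩
  have h1 : (1 : unitInterval) ∈ γ ⁻¹' (Q '' strand φ τ y₀ v m) := hu ▸ mem_univ _
  simpa using h1

theorem pathComponent_eq_strand {r : R} {m : ℤ} (hr : r ∈ Q '' strand φ τ y₀ v m) :
    pathComponent r = Q '' strand φ τ y₀ v m := by
  ext r'
  constructor
  · exact fun h => C.mem_strand_of_joined H hr h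
  · rintro ⟨x', hx', rfl⟩
    obtain ⟨x, hx, rfl⟩ := hr
    exact (H.joined_of_mem_strand hx hx').map C.quot.continuous

theorem image_strand_eq_pathComponent (k : R ≃ₜ R) {r : R} {m : ℤ}
    (hr : r ∈ k '' (Q '' strand φ τ y₀ v m)) :
    k '' (Q '' strand φ τ y₀ v m) = pathComponent r := by
  obtain ⟨s, hs, rfl⟩ := hr
  rw [← C.pathComponent_eq_strand H hs, k.image_pathComponent_eq]

omit [CompactSpace Y] in
theorem strand_injective {m m' : ℤ} (h : Q '' strand φ τ y₀ v m = Q '' strand φ τ y₀ v m') :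
    m = m' := by
  obtain ⟨x, hx⟩ := H.exists_over (φ ((m + 1) * τ) y₀)
  have h1 : x ∈ strand φ τ y₀ v m := ⟨_, ⟨by linarith [H.pos], le_rfl⟩, hx⟩
  obtain ⟨t, ht, hxt⟩ := C.mem_of_mem_image (C.none_of_line hx) (h ▸ mem_image_of_mem Q h1)
  rw [← H.eq_of_apply_eq (hx.symm.trans hxt)] at ht
  have h3 : (m' : ℝ) < m + 1 := lt_of_mul_lt_mul_right ht.1 H.pos.le
  have h4 : (m : ℝ) + 1 ≤ m' + 1 := le_of_mul_le_mul_right ht.2 H.pos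
  have h5 : m' < m + 1 := by exact_mod_cast h3
  have h6 : m + 1 ≤ m' + 1 := by exact_mod_cast h4
  omega

omit H in
/-- The boundary points of a strand lie over its missing end point. -/
theorem frontier_strand_subset {m : ℤ} {r : R}
    (hr : r ∈ closure (Q '' strand φ τ y₀ v m) \ Q '' strand φ τ y₀ v m) :
    ∃ x, x.1.1 = φ (m * τ) y₀ ∧ Q x = r := by
  obtain ⟨x, hx | hx, rfl⟩ := C.closure_strand_subset m hr.1
  · exact (hr.2 (mem_image_of_mem Q hx)).elim
  · exact ⟨x, hx, rfl⟩

/-- A closed strand would have a closed projection, but the projection is an arc without its left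
end point. -/
theorem frontier_strand_nonempty (m : ℤ) :
    (closure (Q '' strand φ τ y₀ v m) \ Q '' strand φ τ y₀ v m).Nonempty := by
  rw [sdiff_nonempty]
  intro h
  have h1 : IsClosed (strand φ τ y₀ v m) := by
    have h2 : Q ⁻¹' (Q '' strand φ τ y₀ v m) = strand φ τ y₀ v m := by
      refine Subset.antisymm ?_ (subset_preimage_image _ _)
      rintro x ⟨x', hx', h⟩
      rwa [← C.eq_of_none (C.none_of_mem_strand hx') h]
    rw [← h2]
    exact (isClosed_of_closure_subset h).preimage C.quot.continuous
  have h3 := isClosedMap_itinerary_fst _ h1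
  have h4 : φ (m * τ) y₀ ∈ closure ((fun t => φ t y₀) '' Ioo (m * τ) ((m + 1) * τ)) := by
    have hcont : Continuous fun t => φ t y₀ := by fun_prop
    refine image_closure_subset_closure_image hcont (mem_image_of_mem _ ?_)
    rw [closure_Ioo (by linarith [H.pos])]
    exact left_mem_Icc.2 (by linarith [H.pos])
  have h5 := closure_minimal (t := (fun x : ItinerarySpace φ τ y₀ v => x.1.1) ''
      strand φ τ y₀ v m) (by
    rintro _ ⟨t, ht, rfl⟩
    obtain ⟨x, hx⟩ := H.exists_over (φ t y₀)
    exact ⟨x, ⟨t, Ioo_subset_Ioc_self ht, hx⟩, hx⟩) h3 h4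
  obtain ⟨x, ⟨t, ht, hx⟩, hx'⟩ := h5
  have h6 := H.eq_of_apply_eq (hx.symm.trans hx')
  rw [h6] at ht
  exact lt_irrefl _ ht.1

/-- Points over the image of a strand under a homeomorphism lie in strands. -/
theorem exists_mem_strand_of_mem_image (k : R ≃ₜ R) {n : ℤ} {e : ItinerarySpace φ τ y₀ v}
    (hek : Q e ∈ k '' (Q '' strand φ τ y₀ v n)) :
    ∃ m, e ∈ strand φ τ y₀ v m := by
  by_contra hcon
  have hline : ∀ s, e.1.1 ≠ φ s y₀ := fun s hs => hcon (H.exists_mem_strand hs)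
  have hτ := H.pos
  -- The points over an arc of length `τ` on the flow line of `e`; `k.symm` carries their images
  -- into the strand `n`.
  set K : Set (ItinerarySpace φ τ y₀ v) := {x | x.1.1 ∈ (fun t => φ t e.1.1) '' Icc 0 τ} with hKdef
  have hKcl : IsClosed K :=
    (isCompact_Icc.image (by fun_prop : Continuous fun t => φ t e.1.1)).isClosed.preimage
      (by fun_prop)
  have : CompactSpace (ItinerarySpace φ τ y₀ v) :=
    isCompact_iff_compactSpace.1 isClosed_closure.isCompact
  have hKk : ∀ x ∈ K, k.symm (Q x) ∈ Q '' strand φ τ y₀ v n := by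
    rintro x ⟨t, ht, hx⟩
    have h1 : Joined e x := H.joined_off_line hline hx.symm
    have h2 := C.image_strand_eq_pathComponent H k hek
    have h3 : Q x ∈ k '' (Q '' strand φ τ y₀ v n) := by
      rw [h2]
      exact h1.map C.quot.continuous
    obtain ⟨s, hs, hs'⟩ := h3
    rw [← hs', k.symm_apply_apply]
    exact hs
  set σ := Function.surjInv C.quot.surjective
  have hσz : ∀ z ∈ strand φ τ y₀ v n, σ (Q z) = z := fun z hz =>
    C.surjInv_apply (C.none_of_mem_strand hz)
  have hσ : ContinuousOn (fun x => (σ (k.symm (Q x))).1.1) K := by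
    have h1 : ContinuousOn (fun x => σ (k.symm (Q x))) K := by
      refine C.continuousOn_surjInv.comp
        (k.symm.continuous.comp C.quot.continuous).continuousOn fun x hx => ?_
      exact image_mono (fun z hz => C.none_of_mem_strand hz) (hKk x hx)
    exact (continuous_fst.comp continuous_subtype_val).comp_continuousOn h1
  set D := (fun x => (σ (k.symm (Q x))).1.1) '' K with hD
  have hDcl : IsClosed D := (hKcl.isCompact.image_of_continuousOn hσ).isClosed
  have hDline : ∀ y ∈ D, ∃ t ∈ Ioc (n * τ) ((n + 1) * τ), y = φ t y₀ := by
    rintro _ ⟨x, hx, rfl⟩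
    obtain ⟨z, hz, hzx⟩ := hKk x hx
    simp only
    rw [← hzx, hσz z hz]
    exact hz
  have hDn : φ (n * τ) y₀ ∈ Dᶜ := by
    intro h
    obtain ⟨t, ht, h1⟩ := hDline _ h
    rw [← H.eq_of_apply_eq h1] at ht
    exact lt_irrefl _ ht.1
  have hcont : Continuous fun t => φ t y₀ := by fun_prop
  obtain ⟨δ, hδ, hδball⟩ := Metric.mem_nhds_iff.1
    (hcont.continuousAt.preimage_mem_nhds (hDcl.isOpen_compl.mem_nhds hDn))
  -- The compact set `D` avoids the missing end point of the strand, so it lies in an arc `J` of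
  -- length `τ - δ'`. The time `L`, strictly between `τ - δ'` and `τ`, moves `J` off itself, and so
  -- it does with a neighbourhood `O`.
  set δ' := min δ τ with hδ'
  have hδ'0 : 0 < δ' := lt_min hδ hτ
  have hδ'τ : δ' ≤ τ := min_le_right _ _
  set J := (fun t => φ t y₀) '' Icc (n * τ + δ') ((n + 1) * τ) with hJ
  have hDJ : D ⊆ J := by
    intro y hy
    obtain ⟨t, ht, rfl⟩ := hDline y hy
    refine ⟨t, ⟨?_, ht.2⟩, rfl⟩
    by_contra! h
    refine (show t ∉ Metric.ball (n * τ) δ from fun h => hδball h hy) ?_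
    have : δ' ≤ δ := min_le_left _ _
    rw [Metric.mem_ball, Real.dist_eq, abs_lt]
    constructor <;> linarith [ht.1]
  set L := τ - δ' / 2 with hL
  have hJc : IsCompact J := isCompact_Icc.image hcont
  have hJd : Disjoint J (φ L '' J) := by
    rw [Set.disjoint_left]
    rintro _ ⟨s, hs, rfl⟩ ⟨_, ⟨t, ht, rfl⟩, h⟩
    simp only [← Flow.map_add] at h
    have h1 := H.eq_of_apply_eq h
    linarith [hs.1, hs.2, ht.1, ht.2]
  obtain ⟨O₁, O₂, hO₁, hO₂, hJO₁, hJO₂, hO⟩ := SeparatedNhds.of_isCompact_isCompact hJc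
    (hJc.image (φ.continuous_toFun L)) hJd
  set O := O₁ ∩ (φ L ⁻¹' O₂ ∩ {y | ρ y = none}) with hOdef
  have hOo : IsOpen O := hO₁.inter ((hO₂.preimage (φ.continuous_toFun L)).inter C.isOpen_none)
  have hOL : ∀ y ∈ O, φ L y ∉ O := fun y hy hy' => Set.disjoint_left.1 hO hy'.1 hy.2.1
  have hJO : J ⊆ O := by
    intro y hy
    refine ⟨hJO₁ hy, hJO₂ (mem_image_of_mem _ hy), ?_⟩
    obtain ⟨t, -, rfl⟩ := hy
    exact (C.flow _ _).trans C.base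
  set V : Set (ItinerarySpace φ τ y₀ v) := {x | x.1.1 ∈ O} with hV
  have hVo : IsOpen V := hOo.preimage (by fun_prop)
  have hVQ : IsOpen (Q '' V) := C.isOpen_image hVo fun x hx => hx.2.2
  set G : Set (ItinerarySpace φ τ y₀ v) := (fun x => k.symm (Q x)) ⁻¹' (Q '' V) with hG
  have hGo : IsOpen G := hVQ.preimage (k.symm.continuous.comp C.quot.continuous)
  have hKG : K ⊆ G := by
    intro x hx
    obtain ⟨z, hz, hzx⟩ := hKk x hx
    refine ⟨z, hJO (hDJ ⟨x, hx, ?_⟩), hzx⟩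
    simp only
    rw [← hzx, hσz z hz]
  have hN := isClosedMap_iff_kernImage.1
    (isClosedMap_itinerary_fst (φ := φ) (τ := τ) (y₀ := y₀) (v := v)) hGo
  have hNe : ∀ᶠ y in 𝓝 e.1.1, ∀ t ∈ Icc 0 τ,
      φ t y ∈ kernImage (fun x : ItinerarySpace φ τ y₀ v => x.1.1) G := by
    refine isCompact_Icc.eventually_forall_of_forall_eventually fun t ht => ?_
    have h1 : Continuous fun z : Y × ℝ => φ z.2 z.1 := by fun_prop
    refine h1.continuousAt.eventually_mem (hN.mem_nhds ?_)
    intro x hx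
    exact hKG ⟨t, ht, hx.symm⟩
  obtain ⟨O₃, hO₃, hO₃o, heO₃⟩ := eventually_nhds_iff.1 hNe
  -- By density some `φ (mτ) y₀` is so close to the base point of `e` that the whole strand `m` lies
  -- in `G`.
  obtain ⟨_, hyO₃, ⟨m, -, rfl⟩⟩ := (H.dense 0).inter_open_nonempty O₃ hO₃o ⟨_, heO₃⟩
  have hmG : ∀ x ∈ strand φ τ y₀ v m, k.symm (Q x) ∈ Q '' V := by
    rintro x ⟨t, ht, hx⟩
    refine hO₃ _ hyO₃ (t - m * τ) ⟨by linarith [ht.1], by linarith [ht.2]⟩ ?_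
    rw [← Flow.map_add, sub_add_cancel]
    exact hx
  obtain ⟨x, hx⟩ := H.strand_nonempty m
  obtain ⟨z, hzV, hzx⟩ := hmG x hx
  have hcomp : k.symm '' (Q '' strand φ τ y₀ v m) = pathComponent (Q z) := by
    rw [hzx]
    exact C.image_strand_eq_pathComponent H k.symm
      (mem_image_of_mem _ (mem_image_of_mem Q hx))
  have hsub : pathComponent (Q z) ⊆ Q '' V := by
    rw [← hcomp]
    rintro _ ⟨_, ⟨x', hx', rfl⟩, rfl⟩
    exact hmG x' hx'
  -- The path component of `Q z` reaches two base points at time distance `L` on one flow line,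
  -- against the choice of `O`. On a strand `j` the times `jτ + δ'/4` and `(j+1)τ - δ'/4` serve.
  by_cases hz : ∃ s, z.1.1 = φ s y₀
  · obtain ⟨s, hs⟩ := hz
    obtain ⟨j, hj⟩ := H.exists_mem_strand hs
    have hjV : ∀ t ∈ Ioc (j * τ) ((j + 1) * τ), φ t y₀ ∈ O := by
      intro t ht
      obtain ⟨x', hx'⟩ := H.exists_over (φ t y₀)
      have h1 : Q x' ∈ pathComponent (Q z) := by
        rw [C.pathComponent_eq_strand H (mem_image_of_mem Q hj)]
        exact mem_image_of_mem Q ⟨t, ht, hx'⟩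
      have h2 := C.mem_of_mem_image (C.none_of_line hx') (hsub h1)
      rwa [hV, mem_ofPred_eq, hx'] at h2
    refine hOL _ (hjV (j * τ + δ' / 4) ⟨by linarith, by linarith⟩) ?_
    rw [← Flow.map_add]
    exact hjV _ ⟨by linarith, by linarith⟩
  · push Not at hz
    obtain ⟨z', hz'⟩ := H.exists_over (φ L z.1.1)
    have h1 : Q z' ∈ pathComponent (Q z) := (H.joined_off_line hz hz').map C.quot.continuous
    have h2 : ρ z'.1.1 = none := by
      rw [hz', C.flow]
      exact hzV.2.2
    have h3 := C.mem_of_mem_image h2 (hsub h1)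
    rw [hV, mem_ofPred_eq, hz'] at h3
    exact hOL _ hzV h3

/-- The preceding strand is determined topologically: it is the path component that contains the
frontier points. -/
theorem image_strand_pred (k : R ≃ₜ R) {n m : ℤ}
    (h : k '' (Q '' strand φ τ y₀ v n) = Q '' strand φ τ y₀ v m) :
    k '' (Q '' strand φ τ y₀ v (n - 1)) = Q '' strand φ τ y₀ v (m - 1) := by
  have key : ∀ m : ℤ, closure (Q '' strand φ τ y₀ v m) \ Q '' strand φ τ y₀ v m ⊆
      Q '' strand φ τ y₀ v (m - 1) := by
    intro m r hr
    obtain ⟨x, hx, rfl⟩ := C.frontier_strand_subset hr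
    refine mem_image_of_mem Q ⟨_, ⟨?_, ?_⟩, hx⟩
    · push_cast
      linarith [H.pos]
    · push_cast
      linarith
  obtain ⟨d, hd⟩ := C.frontier_strand_nonempty H n
  have h1 : k d ∈ Q '' strand φ τ y₀ v (m - 1) := by
    refine key m ?_
    rw [← h, ← k.image_closure, ← image_sdiff k.injective]
    exact mem_image_of_mem k hd
  rw [C.image_strand_eq_pathComponent H k (mem_image_of_mem k (key n hd)),
    C.pathComponent_eq_strand H h1]

/-- A homeomorphism permutes the strands by a translation. -/
theorem exists_image_strand (k : R ≃ₜ R) : ∃ c : ℤ, ∀ n : ℤ,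
    k '' (Q '' strand φ τ y₀ v n) = Q '' strand φ τ y₀ v (n + c) := by
  have hex : ∀ n : ℤ, ∃ m, k '' (Q '' strand φ τ y₀ v n) = Q '' strand φ τ y₀ v m := by
    intro n
    obtain ⟨x, hx⟩ := H.strand_nonempty n
    obtain ⟨e, he⟩ := C.quot.surjective (k (Q x))
    have hek : Q e ∈ k '' (Q '' strand φ τ y₀ v n) :=
      he ▸ mem_image_of_mem k (mem_image_of_mem Q hx)
    obtain ⟨m, hm⟩ := C.exists_mem_strand_of_mem_image H k hek
    exact ⟨m, by rw [C.image_strand_eq_pathComponent H k hek,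
      C.pathComponent_eq_strand H (mem_image_of_mem Q hm)]⟩
  choose F hF using hex
  have hstep : ∀ n, F (n - 1) = F n - 1 := fun n =>
    C.strand_injective H ((hF (n - 1)).symm.trans (C.image_strand_pred H k (hF n)))
  refine ⟨F 0, fun n => ?_⟩
  have e : F n = n + F 0 := by
    induction n with
    | zero => simp
    | succ n ih =>
      have := hstep (n + 1)
      rw [add_sub_cancel_right] at this
      omega
    | pred n ih =>
      have := hstep (-n)
      omega
  rw [hF n, e]

/-- A homeomorphism which preserves all strands is the identity. -/
theorem eq_refl_of_image_strand (k : R ≃ₜ R)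
    (h : ∀ n : ℤ, k '' (Q '' strand φ τ y₀ v n) = Q '' strand φ τ y₀ v n) :
    ∀ r, k r = r := by
  have := C.t2Space
  have hoff : ∀ x : ItinerarySpace φ τ y₀ v, (∀ n : ℤ, x.1.1 ≠ φ (n * τ) y₀) →
      k (Q x) = Q x := by
    intro x hx
    by_contra hne
    obtain ⟨O₁, O₂, hO₁, hO₂, h1, h2, hd⟩ := t2_separation hne
    have hG : IsOpen (Q ⁻¹' (k ⁻¹' O₁ ∩ O₂)) :=
      ((hO₁.preimage k.continuous).inter hO₂).preimage C.quot.continuous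
    -- A full fibre over some `φ (nτ) y₀` fits into the neighbourhood. It contains a frontier point
    -- of the strand `n` together with its image under `k`, which the separation forbids.
    obtain ⟨y, ⟨n, -, rfl⟩, hy⟩ := H.exists_fibre_subset hx hG ⟨h1, h2⟩ (H.dense 0)
    obtain ⟨d, hdm⟩ := C.frontier_strand_nonempty H n
    have hkd : k d ∈ closure (Q '' strand φ τ y₀ v n) \ Q '' strand φ τ y₀ v n := by
      have h3 := mem_image_of_mem k hdm
      rwa [image_sdiff k.injective, k.image_closure, h] at h3
    obtain ⟨z, hz, hzd⟩ := C.frontier_strand_subset hdm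
    obtain ⟨z', hz', hzd'⟩ := C.frontier_strand_subset hkd
    have h4 := (hy z hz).1
    have h5 := (hy z' hz').2
    rw [hzd] at h4
    rw [hzd'] at h5
    exact Set.disjoint_left.1 hd h4 h5
  have heq : (fun x => k (Q x)) = Q :=
    Continuous.ext_on dense_itinerary_off_orbit (k.continuous.comp C.quot.continuous)
      C.quot.continuous hoff
  intro r
  obtain ⟨x, rfl⟩ := C.quot.surjective r
  exact congrFun heq x

variable {hR : R ≃ₜ R} (hhR : ∀ x, hR (Q x) = Q (itineraryShift φ τ y₀ v x))
include hhR

theorem zpow_image_strand (c n : ℤ) :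
    (hR ^ c : R ≃ₜ R) '' (Q '' strand φ τ y₀ v n) = Q '' strand φ τ y₀ v (n + c) := by
  obtain ⟨x, t, ht, hx⟩ := H.strand_nonempty n
  obtain ⟨x', h1, h2⟩ := zpow_apply_of_lifts_shift hhR c x
  rw [C.image_strand_eq_pathComponent H _
    (mem_image_of_mem _ (mem_image_of_mem Q ⟨t, ht, hx⟩)), h1]
  refine C.pathComponent_eq_strand H (mem_image_of_mem Q ⟨t + c * τ, ⟨?_, ?_⟩, ?_⟩)
  · push_cast
    linarith [ht.1]
  · push_cast
    linarith [ht.2]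
  · rw [h2, hx, ← Flow.map_add, add_comm]

/-- Every homeomorphism of the collapsed space is a power of the shift. -/
theorem exists_eq_zpow (k : R ≃ₜ R) : ∃ n : ℤ, k = hR ^ n := by
  obtain ⟨c, hc⟩ := C.exists_image_strand H k
  refine ⟨c, ?_⟩
  have h1 := C.eq_refl_of_image_strand H (hR ^ (-c) * k) fun n => by
    have : (hR ^ (-c) * k : R ≃ₜ R) '' (Q '' strand φ τ y₀ v n) =
        (hR ^ (-c) : R ≃ₜ R) '' (k '' (Q '' strand φ τ y₀ v n)) :=
      image_comp (hR ^ (-c) : R ≃ₜ R) k _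
    rw [this, hc, C.zpow_image_strand H hhR, add_neg_cancel_right]
  have h2 : hR ^ (-c) * k = 1 := Homeomorph.ext h1
  rwa [zpow_neg, inv_mul_eq_one, eq_comm] at h2

theorem isTopTransitive_zpow {n : ℤ}
    (hd : Dense {y | ∃ k : ℕ, 1 ≤ k ∧ y = φ ((n * k : ℤ) * τ) y₀}) :
    IsTopTransitive (hR ^ n : R ≃ₜ R) := by
  have hiter : ∀ (k : ℕ) (x : ItinerarySpace φ τ y₀ v), ∃ x' : ItinerarySpace φ τ y₀ v,
      (hR ^ n : R ≃ₜ R)^[k] (Q x) = Q x' ∧ x'.1.1 = φ ((n * k : ℤ) * τ) x.1.1 := by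
    intro k
    induction k with
    | zero => exact fun x => ⟨x, rfl, by simp⟩
    | succ k ih =>
      intro x
      obtain ⟨x₁, h1, h1'⟩ := zpow_apply_of_lifts_shift hhR n x
      obtain ⟨x₂, h2, h2'⟩ := ih x₁
      refine ⟨x₂, ?_, ?_⟩
      · rw [Function.iterate_succ_apply, h1, h2]
      · rw [h2', h1', ← Flow.map_add]
        congr 1
        push_cast
        ring
  -- An open set contains a full fibre over some point of any dense subset of `Y`, so it is enough
  -- that the base orbit is dense.
  have hvisit : ∀ (s : ℝ) (x : ItinerarySpace φ τ y₀ v), x.1.1 = φ s y₀ → ∀ O : Set R, IsOpen O →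
      O.Nonempty → ∃ k : ℕ, 1 ≤ k ∧ (hR ^ n : R ≃ₜ R)^[k] (Q x) ∈ O := by
    intro s x hx O hO hOne
    have hd' : Dense {y | ∃ k : ℕ, 1 ≤ k ∧ y = φ ((n * k : ℤ) * τ) (φ s y₀)} := by
      have hsurj : Function.Surjective (φ s) := fun y =>
        ⟨φ (-s) y, by rw [← Flow.map_add, add_neg_cancel, Flow.map_zero_apply]⟩
      refine (hsurj.denseRange.dense_image (φ.continuous_toFun s) hd).mono ?_
      rintro _ ⟨_, ⟨k, hk, rfl⟩, rfl⟩
      exact ⟨k, hk, by rw [← Flow.map_add, ← Flow.map_add, add_comm]⟩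
    obtain ⟨y, ⟨k, hk, rfl⟩, hy⟩ := H.exists_orbit_fibre_subset (hO.preimage C.quot.continuous)
      (hOne.preimage C.quot.surjective) hd'
    obtain ⟨x', h1, h2⟩ := hiter k x
    refine ⟨k, hk, ?_⟩
    rw [h1]
    exact hy x' (by rw [h2, hx])
  obtain ⟨x₀, hx₀⟩ := H.exists_over y₀
  refine Dense.closure_eq (dense_iff_inter_open.2 ?_)
  rintro O hO ⟨⟨r, r'⟩, hr⟩
  obtain ⟨O₁, O₂, hO₁, hO₂, hr₁, hr₂, hsub⟩ := isOpen_prod_iff.1 hO r r' hr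
  -- The orbit first enters `O₁`; the point reached still lies over the flow line of `y₀`, so its
  -- own orbit enters `O₂`.
  obtain ⟨i, hi, hi'⟩ := hvisit 0 x₀ (by simpa using hx₀) O₁ hO₁ ⟨r, hr₁⟩
  obtain ⟨x₁, h1, h1'⟩ := hiter i x₀
  rw [h1] at hi'
  obtain ⟨j, hj, hj'⟩ := hvisit _ x₁ (by rw [h1', hx₀]) O₂ hO₂ ⟨r', hr₂⟩
  exact ⟨(Q x₁, _), hsub ⟨hi', hj'⟩, j, hj, rfl⟩

end IsCollapse

end Collapse


/-! ### The extension space as an itinerary space -/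

section WeightedSum

variable {Y : Type*} [TopologicalSpace Y]

/-- The weighted sum of a sequence in `[0,1]`, as a map over `Y`. -/
def weightedSum (a : ℤ → ℝ) (p : Y × (ℤ → unitInterval)) : Y × unitInterval :=
  (p.1, projIcc (0 : ℝ) 1 zero_le_one (∑' n, a n * (p.2 n : ℝ)))

variable {a : ℤ → ℝ} (ha_pos : ∀ n, 0 < a n) (ha_sum : HasSum a 1)
include ha_pos ha_sum

theorem summable_weighted (s : ℤ → unitInterval) : Summable fun n => a n * (s n : ℝ) :=
  Summable.of_nonneg_of_le (fun n => mul_nonneg (ha_pos n).le (s n).2.1)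
    (fun n => mul_le_of_le_one_right (ha_pos n).le (s n).2.2) ha_sum.summable

omit [TopologicalSpace Y] in
theorem weightedSum_snd (p : Y × (ℤ → unitInterval)) :
    ((weightedSum a p).2 : ℝ) = ∑' n, a n * (p.2 n : ℝ) := by
  have h0 : 0 ≤ ∑' n, a n * (p.2 n : ℝ) :=
    tsum_nonneg fun n => mul_nonneg (ha_pos n).le (p.2 n).2.1
  have h1 : ∑' n, a n * (p.2 n : ℝ) ≤ 1 := by
    rw [← ha_sum.tsum_eq]
    exact (summable_weighted ha_pos ha_sum p.2).tsum_le_tsum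
      (fun n => mul_le_of_le_one_right (ha_pos n).le (p.2 n).2.2) ha_sum.summable
  simp only [weightedSum]
  rw [projIcc_of_mem zero_le_one ⟨h0, h1⟩]

theorem continuous_weightedSum :
    Continuous (weightedSum a : Y × (ℤ → unitInterval) → Y × unitInterval) := by
  refine continuous_fst.prodMk (continuous_projIcc.comp ?_)
  refine continuous_tsum (fun n => by fun_prop) ha_sum.summable fun n p => ?_
  rw [Real.norm_of_nonneg (mul_nonneg (ha_pos n).le (p.2 n).2.1)]
  exact mul_le_of_le_one_right (ha_pos n).le (p.2 n).2.2

variable {φ : Flow ℝ Y} {τ : ℝ} {y₀ : Y} {f : Equiv.Perm Y}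
  (hf : ∀ (n : ℤ) (y : Y), (f ^ n) y = φ (n * τ) y) {u : Y → ℝ} {v : Y → unitInterval}
  (huv : ∀ y, y ≠ y₀ → (v y : ℝ) = u y)
include hf huv

theorem orbitAverage_eq {p : Y × (ℤ → unitInterval)} (hp : p ∈ itineraryGraph φ τ y₀ v) :
    ((weightedSum a p).2 : ℝ) = orbitAverage f a u p.1 := by
  rw [weightedSum_snd ha_pos ha_sum, orbitAverage]
  refine tsum_congr fun n => ?_
  rw [hp.2 n, hf, huv]
  exact (ne_zpow_mul_iff _).1 hp.1 n

theorem image_weightedSum_itineraryGraph :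
    weightedSum a '' itineraryGraph φ τ y₀ v = averageGraph f y₀ a u := by
  ext q
  constructor
  · rintro ⟨p, hp, rfl⟩
    refine ⟨fun n h => ?_, orbitAverage_eq ha_pos ha_sum hf huv hp⟩
    exact hp.1 n (by rw [← hf]; exact h.symm)
  · rintro ⟨h1, h2⟩
    have hp : (q.1, fun n : ℤ => v (φ (n * τ) q.1)) ∈ itineraryGraph φ τ y₀ v :=
      ⟨fun n h => h1 n (by rw [hf]; exact h.symm), fun n => rfl⟩
    refine ⟨_, hp, Prod.ext rfl (Subtype.ext ?_)⟩
    rw [orbitAverage_eq ha_pos ha_sum hf huv hp, h2]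

variable [CompactSpace Y] [T2Space Y]

theorem image_weightedSum_closure :
    weightedSum a '' closure (itineraryGraph φ τ y₀ v) = closure (averageGraph f y₀ a u) := by
  have hc := continuous_weightedSum (Y := Y) ha_pos ha_sum
  rw [← image_weightedSum_itineraryGraph ha_pos ha_sum hf huv]
  exact (hc.isClosedMap.closure_image_eq_of_continuous hc _).symm

omit hf huv [CompactSpace Y] in
-- Two sequences over the same orbit point differ in at most one coordinate, and its weight is
-- positive.
theorem OscillatingFlow.weightedSum_injOn (H : OscillatingFlow φ τ y₀ v)
    {x x' : ItinerarySpace φ τ y₀ v} (h : weightedSum a x.1 = weightedSum a x'.1) : x = x' := by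
  have h1 : x.1.1 = x'.1.1 := (Prod.ext_iff.1 h).1
  by_cases ho : ∀ n : ℤ, x.1.1 ≠ φ (n * τ) y₀
  · exact H.ext_off_orbit h1 ho
  push Not at ho
  obtain ⟨m, hm⟩ := ho
  refine H.ext_on_orbit hm (h1 ▸ hm) (Subtype.ext ?_)
  have h2 : ∑' n, (a n * (x.1.2 n : ℝ) - a n * (x'.1.2 n : ℝ)) = 0 := by
    rw [(summable_weighted ha_pos ha_sum x.1.2).tsum_sub (summable_weighted ha_pos ha_sum x'.1.2),
      ← weightedSum_snd ha_pos ha_sum, ← weightedSum_snd ha_pos ha_sum, h, sub_self]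
  rw [tsum_eq_single (-m)] at h2
  · exact mul_left_cancel₀ (ha_pos _).ne' (sub_eq_zero.1 h2)
  · intro n hn
    have h3 : φ (n * τ) x.1.1 ≠ y₀ := by
      rw [hm, ← Flow.map_add, ← add_mul]
      refine H.apply_ne (mul_ne_zero ?_ H.pos.ne')
      have : n + m ≠ 0 := by omega
      exact_mod_cast this
    rw [H.coord_eq x n h3, H.coord_eq x' n (h1 ▸ h3), h1, sub_self]

/-- The weighted sum identifies the itinerary space with the extension space. -/
def OscillatingFlow.extensionHomeo (H : OscillatingFlow φ τ y₀ v) :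
    ItinerarySpace φ τ y₀ v ≃ₜ ExtensionSpace f y₀ a u :=
  have : CompactSpace (ItinerarySpace φ τ y₀ v) :=
    isCompact_iff_compactSpace.1 isClosed_closure.isCompact
  let F : ItinerarySpace φ τ y₀ v → ExtensionSpace f y₀ a u := fun x =>
    ⟨weightedSum a x.1, image_weightedSum_closure ha_pos ha_sum hf huv ▸ mem_image_of_mem _ x.2⟩
  have hF : Function.Bijective F :=
    ⟨fun _ _ h => H.weightedSum_injOn ha_pos ha_sum (congrArg Subtype.val h), fun z => by
      obtain ⟨p, hp, h⟩ := (image_weightedSum_closure ha_pos ha_sum hf huv).superset z.2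
      exact ⟨⟨p, hp⟩, Subtype.ext h⟩⟩
  Continuous.homeoOfEquivCompactToT2 (f := Equiv.ofBijective F hF)
    (((continuous_weightedSum ha_pos ha_sum).comp continuous_subtype_val).subtype_mk _)

theorem OscillatingFlow.extensionHomeo_symm_fst (H : OscillatingFlow φ τ y₀ v)
    (z : ExtensionSpace f y₀ a u) :
    ((H.extensionHomeo ha_pos ha_sum hf huv).symm z).1.1 = z.1.1 := by
  obtain ⟨x, rfl⟩ := (H.extensionHomeo ha_pos ha_sum hf huv).surjective z
  rw [Homeomorph.symm_apply_apply]
  rfl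

/-- The shift, transported to the extension space. -/
def OscillatingFlow.extensionShift (H : OscillatingFlow φ τ y₀ v) :
    ExtensionSpace f y₀ a u ≃ₜ ExtensionSpace f y₀ a u :=
  (H.extensionHomeo ha_pos ha_sum hf huv).symm.trans
    ((itineraryShift φ τ y₀ v).trans (H.extensionHomeo ha_pos ha_sum hf huv))

theorem OscillatingFlow.extensionShift_fst (H : OscillatingFlow φ τ y₀ v)
    (z : ExtensionSpace f y₀ a u) :
    (H.extensionShift ha_pos ha_sum hf huv z).1.1 = φ τ z.1.1 :=
  congrArg (φ τ) (H.extensionHomeo_symm_fst ha_pos ha_sum hf huv z)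

theorem OscillatingFlow.extendsGraphMap (H : OscillatingFlow φ τ y₀ v) :
    ExtendsGraphMap f y₀ a u (H.extensionShift ha_pos ha_sum hf huv) := by
  intro z hz
  have hfτ : ∀ y, f y = φ τ y := fun y => by simpa using hf 1 y
  refine ⟨?_, by rw [H.extensionShift_fst, hfτ]⟩
  refine (image_weightedSum_itineraryGraph ha_pos ha_sum hf huv).subset
    (mem_image_of_mem _ (H.mem_itineraryGraph _ fun n hn => ?_))
  replace hn : φ τ z.1.1 = φ (n * τ) y₀ :=
    (H.extensionShift_fst ha_pos ha_sum hf huv z).symm.trans hn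
  rw [Flow.apply_eq_iff_neg, ← Flow.map_add] at hn
  refine hz.1 (n - 1) ?_
  rw [hf, hn]
  congr 1
  push_cast
  ring

end WeightedSum

/-! ### Application to the suspension flow. -/

theorem exists_mul_one_sub_cos_eq (s : unitInterval) {ε : ℝ} (hε : 0 < ε) :
    ∃ t ∈ Ioo 0 ε, t ≤ 1 / 2 ∧ 1 / 2 * (1 - Real.cos (Real.pi / t)) = s := by
  have hπ := Real.pi_pos
  obtain ⟨N, hN⟩ := exists_nat_gt (1 / ε)
  have hac := Real.arccos_nonneg (1 - 2 * (s : ℝ))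
  -- `θ` solves `cos θ = 1 - 2s`. The `N` full turns make `t = π / θ` smaller than `ε`, and one more
  -- ensures `t ≤ 1/2`.
  set θ := Real.arccos (1 - 2 * (s : ℝ)) + ((N + 1 : ℕ) : ℝ) * (2 * Real.pi) with hθ
  have hN0 : (0 : ℝ) ≤ N := Nat.cast_nonneg N
  have h1 : 2 * Real.pi ≤ θ := by
    rw [hθ]
    push_cast
    nlinarith
  have h2 : Real.pi * (1 / ε) < θ := by
    rw [hθ]
    push_cast
    nlinarith
  have hθ0 : 0 < θ := by linarith
  refine ⟨Real.pi / θ, ⟨by positivity, ?_⟩, ?_, ?_⟩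
  · rw [div_lt_iff₀ hθ0]
    rw [mul_one_div, div_lt_iff₀ hε] at h2
    linarith
  · rw [div_le_iff₀ hθ0]
    linarith
  · rw [div_div_cancel₀ hπ.ne', hθ, Real.cos_add_nat_mul_two_pi,
      Real.cos_arccos (by linarith [s.2.2]) (by linarith [s.2.1])]
    ring

theorem oscillatingFlow_suspFlow {W : Type*} [TopologicalSpace W] [T1Space W] [Nontrivial W]
    [TotallyDisconnectedSpace W] (g : W ≃ₜ W) (x₀ : W)
    (hx₀ : ∀ n : ℤ, n ≠ 0 → IsTransitivePoint (g ^ n : W ≃ₜ W) x₀) (τ : ℝ) (hτ : 0 < τ)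
    (hd : Dense {y | ∃ k : ℕ, 1 ≤ k ∧ y = suspFlow g ((1 * k : ℤ) * τ) (basePoint g x₀)})
    (u : Suspension g → ℝ) (hu_cont : ContinuousOn u {basePoint g x₀}ᶜ)
    (hu_neg : ∀ t ∈ Ico (-(1 / 2) : ℝ) 0, u (suspensionFlow g t (basePoint g x₀)) = 0)
    (hu_pos : ∀ t ∈ Ioc (0 : ℝ) (1 / 2),
      u (suspensionFlow g t (basePoint g x₀)) = 1 / 2 * (1 - Real.cos (Real.pi / t))) :
    OscillatingFlow (suspFlow g) τ (basePoint g x₀)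
      (fun y => projIcc (0 : ℝ) 1 zero_le_one (u y)) where
  pos := hτ
  inj := suspFlow_basePoint_injective g x₀ hx₀
  cont := continuous_projIcc.comp_continuousOn hu_cont
  neg t ht := (congrArg _ (hu_neg t ht)).trans (projIcc_left zero_le_one)
  osc s ε hε := by
    obtain ⟨t, ht, ht2, hts⟩ := exists_mul_one_sub_cos_eq s hε
    refine ⟨t, ht, (congrArg _ ((hu_pos t ⟨ht.1, ht2⟩).trans hts)).trans ?_⟩
    exact projIcc_val zero_le_one s
  lift := exists_flow_param g
  dense N := by
    have hsurj : Function.Surjective (suspFlow g (N * τ)) := fun y =>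
      ⟨suspFlow g (-(N * τ)) y, by rw [← Flow.map_add, add_neg_cancel, Flow.map_zero_apply]⟩
    refine (hsurj.denseRange.dense_image ((suspFlow g).continuous_toFun _) hd).mono ?_
    rintro _ ⟨_, ⟨k, hk, rfl⟩, rfl⟩
    refine ⟨N + k, by omega, ?_⟩
    rw [← Flow.map_add]
    congr 1
    push_cast
    ring

end

theorem theorem4p08
    {W A : Type*} [TopologicalSpace W]
    [TopologicalSpace A] [CompactSpace A] [TopologicalSpace.MetrizableSpace A]
    -- `W` is a Cantor set and `g` a totally transitive homeomorphism of it
    (hW : Nonempty (W ≃ₜ cantorSet))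
    (g : W ≃ₜ W) (hg : IsTotallyTransitive g)
    -- `x₀` is a transitive point of every `gⁿ`, `n ≠ 0`
    (x₀ : W) (hx₀ : ∀ n : ℤ, n ≠ 0 → IsTransitivePoint (g ^ n : W ≃ₜ W) x₀)
    -- `y₀ = (x₀, 0)` is a transitive point of every nonzero power of the time `τ` map
    (τ : ℝ) (hτ : τ ∈ Ioo (0 : ℝ) 1)
    (hy₀ : ∀ n : ℤ, n ≠ 0 →
      IsTransitivePoint (timeMap g τ ^ n : Equiv.Perm (Suspension g)) (basePoint g x₀))
    -- the weights
    (a : ℤ → ℝ) (ha_pos : ∀ n, 0 < a n) (ha_sum : HasSum a 1)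
    (ha_log : ∃ C : ℝ, ∀ n : ℤ, |Real.log (a n) - Real.log (a (n - 1))| ≤ C)
    -- the function `u`, continuous from the complement of `y₀` to `[0,1]`
    (u : Suspension g → ℝ) (hu_cont : ContinuousOn u {basePoint g x₀}ᶜ)
    (hu_mem : ∀ y, y ≠ basePoint g x₀ → u y ∈ Icc (0 : ℝ) 1)
    (hu_neg : ∀ t ∈ Ico (-(1 / 2) : ℝ) 0, u (suspensionFlow g t (basePoint g x₀)) = 0)
    (hu_pos : ∀ t ∈ Ioc (0 : ℝ) (1 / 2),
      u (suspensionFlow g t (basePoint g x₀)) = 1 / 2 * (1 - Real.cos (Real.pi / t)))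
    -- the proper closed invariant set `B` and the surjection `r : B → A` with `r ∘ g = r`
    (B : Set W) (hB_closed : IsClosed B) (hB_ne : B ≠ univ) (hB : g '' B = B)
    (r : B → A) (hr_cont : Continuous r) (hr_surj : Function.Surjective r)
    (hr : ∀ b b' : B, (b' : W) = g b → r b' = r b) :
    -- the homeomorphism `h` of `X`
    ∃ h : ExtensionSpace (timeMap g τ) (basePoint g x₀) a u ≃ₜ
        ExtensionSpace (timeMap g τ) (basePoint g x₀) a u,
      ExtendsGraphMap (timeMap g τ) (basePoint g x₀) a u h ∧
      -- the homeomorphism `h_r` which it induces on the quotient `X_r`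
      ∃ h_r : CollapsedSpace (timeMap g τ) (basePoint g x₀) a u (suspendedMap g B r hB hr) ≃ₜ
          CollapsedSpace (timeMap g τ) (basePoint g x₀) a u (suspendedMap g B r hB hr),
        (∀ x, h_r (Quotient.mk _ x) = Quotient.mk _ (h x)) ∧
        (∀ k : CollapsedSpace (timeMap g τ) (basePoint g x₀) a u (suspendedMap g B r hB hr) ≃ₜ
            CollapsedSpace (timeMap g τ) (basePoint g x₀) a u (suspendedMap g B r hB hr),
          ∃ n : ℤ, k = h_r ^ n) ∧
        ∀ n : ℤ, n ≠ 0 → IsTopTransitive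
          (h_r ^ n : CollapsedSpace (timeMap g τ) (basePoint g x₀) a u
              (suspendedMap g B r hB hr) ≃ₜ
            CollapsedSpace (timeMap g τ) (basePoint g x₀) a u (suspendedMap g B r hB hr)) := by
  obtain ⟨e⟩ := hW
  have : CompactSpace cantorSet := isCompact_iff_compactSpace.1 isCompact_cantorSet
  have : CompactSpace W := e.symm.compactSpace
  have : T2Space W := e.symm.t2Space
  have : TotallyDisconnectedSpace W :=
    (e.trans cantorSetHomeomorphNatToBool).symm.totallyDisconnectedSpace
  have : Nontrivial W := by
    have : Nontrivial cantorSet := ⟨⟨0, zero_mem_cantorSet⟩, ⟨1 / 4, quarter_mem_cantorSet⟩,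
      fun h => by simpa using congrArg Subtype.val h⟩
    exact e.toEquiv.nontrivial
  have : T2Space (Suspension g) := t2Space_suspension g
  have hd : ∀ n : ℤ, n ≠ 0 →
      Dense {y | ∃ k : ℕ, 1 ≤ k ∧ y = suspFlow g ((n * k : ℤ) * τ) (basePoint g x₀)} := by
    intro n hn
    have h1 := hy₀ n hn
    rw [IsTransitivePoint, ← dense_iff_closure_eq] at h1
    refine h1.mono ?_
    rintro y ⟨k, hk, rfl⟩
    refine ⟨k, hk, ?_⟩
    rw [Equiv.Perm.iterate_eq_pow, ← zpow_natCast, ← zpow_mul, timeMap_zpow]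
  have H := oscillatingFlow_suspFlow g x₀ hx₀ τ hτ.1 (hd 1 one_ne_zero) u hu_cont hu_neg hu_pos
  -- Clamping to `[0,1]` can change `u` only at `y₀`, where its value is arbitrary.
  have huv : ∀ y, y ≠ basePoint g x₀ → (projIcc (0 : ℝ) 1 zero_le_one (u y) : ℝ) = u y :=
    fun y hy => by rw [projIcc_of_mem zero_le_one (hu_mem y hy)]
  have hf := timeMap_zpow g τ
  set ρ := suspendedMap g B r hB hr with hρ
  have hρ_flow : ∀ t y, ρ (suspFlow g t y) = ρ y := suspendedMap_suspFlow g B r hB hr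
  set s := collapseSetoid (timeMap g τ) (basePoint g x₀) a u ρ with hs
  set E := H.extensionHomeo ha_pos ha_sum hf huv with hE
  set h := H.extensionShift ha_pos ha_sum hf huv with hh
  have hfst : ∀ z, (h z).1.1 = suspFlow g τ z.1.1 := H.extensionShift_fst ha_pos ha_sum hf huv
  let h_r : Quotient s ≃ₜ Quotient s := Homeomorph.Quotient.congr h fun x x' => by
    refine or_congr h.injective.eq_iff.symm ?_
    rw [hfst, hfst, hρ_flow, hρ_flow]
  have C : IsCollapse ρ (fun x : ItinerarySpace (suspFlow g) τ (basePoint g x₀)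
      (fun y => projIcc (0 : ℝ) 1 zero_le_one (u y)) => (Quotient.mk s (E x))) :=
    { quot := isQuotientMap_quotient_mk'.comp E.isQuotientMap
      eq_iff := fun x x' => by
        rw [Quotient.eq]
        exact or_congr E.injective.eq_iff Iff.rfl
      flow := hρ_flow
      base := suspendedMap_basePoint_of_transitive g B hB_closed hB_ne r hB hr
        (by simpa using hx₀ 1 one_ne_zero)
      closed := isClosed_suspendedMap_rel g B hB_closed r hr_cont hB hr }
  have hhr : ∀ x, h_r (Quotient.mk s (E x)) =
      Quotient.mk s (E (itineraryShift (suspFlow g) τ (basePoint g x₀) _ x)) := by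
    intro x
    refine congrArg (Quotient.mk s) ?_
    change E (itineraryShift (suspFlow g) τ (basePoint g x₀) _ (E.symm (E x))) = _
    rw [E.symm_apply_apply]
  exact ⟨h, H.extendsGraphMap ha_pos ha_sum hf huv, h_r, fun x => rfl,
    C.exists_eq_zpow H hhr, fun n hn => C.isTopTransitive_zpow H hhr (hd n hn)⟩
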